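/- Let $k>1$ be real and let $$\phi(z)=\sqrt{\frac{1-k^{-1}z^{-1}}{1-k^{-1}z}},$$ the branch being the one analytic on $\mathbb{C}\setminus([0,k^{-1}]\cup[k,\infty))$ with $\phi(1)=1$ (the Ising symbol). Let $c\in\mathbb{C}\setminus[k,\infty)$ and $$\psi(z)=\frac{\phi(z)z-d}{z-c},$$ where $d=\phi(c)c$ if $|c|\ge 1$, and $d\in\mathbb{C}$ is arbitrary if $|c|<1$. For a function $f$ on the unit circle put $[f]_n=\frac1{2\pi}\int_0^{2\pi}f(e^{i\theta})e^{-in\theta}\,d\theta$, let $T_N(f)=([f]_{i-j})_{0\le i,j<N}$ be the $N\times N$ Toeplitz matrix, let $e_0=(1,0,\dots,0)^T\in\mathbb{C}^N$, and let $$F_N[\phi;\psi]=e_0^T\,T_N(\phi)^{-1}\,T_N(\psi)\,e_0 .$$ Then $T_N(\phi)$ is invertible for all sufficiently large $N$ and, as $N\to\infty$, $$F_N[\phi;\psi]=\frac{k^{1/2}}{(k-c)^{1/2}}-\frac{c\,k^{1/2}}{2\pi(k-c)^{3/2}(1-k^{-2})}\,N^{-2}k^{-2N}\bigl(1+O(N^{-1})\bigr),$$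 with principal branches of the powers; the constant in $O(N^{-1})$ may depend on $k$, $c$ and $d$. -/

import Mathlib

noncomputable section

namespace BorderedToeplitz

/-- The `n`-th Fourier coefficient `[f]_n = (1/2π) ∫₀^{2π} f(e^{iθ}) e^{-inθ} dθ` of the
restriction of `f` to the unit circle. -/
def coeff (f : ℂ → ℂ) (n : ℤ) : ℂ :=
  (1 / (2 * (Real.pi : ℂ))) *
    ∫ θ in (0 : ℝ)..(2 * Real.pi),
      f (Complex.exp (θ * Complex.I)) * Complex.exp (-(n * θ * Complex.I))

/-- The `N × N` Toeplitz matrix `T_N(f) = ([f]_{i-j})`, `0 ≤ i, j < N`. -/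
def toeplitz (N : ℕ) (f : ℂ → ℂ) : Matrix (Fin N) (Fin N) ℂ :=
  Matrix.of fun i j => coeff f ((i : ℤ) - (j : ℤ))

/-- The vector `e₀ = (1, 0, …, 0)` in `ℂ^N`. -/
def e0 (N : ℕ) : Fin N → ℂ := fun i => if (i : ℕ) = 0 then 1 else 0

/-- `F_N[φ;ψ] = e₀ᵀ T_N(φ)⁻¹ T_N(ψ) e₀`; it is meaningful when `T_N(φ)` is invertible. -/
def F (N : ℕ) (φ ψ : ℂ → ℂ) : ℂ :=
  dotProduct (e0 N) (((toeplitz N φ)⁻¹ * toeplitz N ψ).mulVec (e0 N))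

/-- The Ising symbol `φ(z) = ((1 - k⁻¹ z⁻¹) / (1 - k⁻¹ z))^{1/2}`, principal square root.
For `k > 1` the quotient lies in `(-∞, 0)` only at points `z` of `(0, k⁻¹) ∪ (k, ∞)`, so this
is the branch analytic off `[0, k⁻¹] ∪ [k, ∞)` with value `1` at `z = 1`. -/
def isingSymbol (k : ℝ) (z : ℂ) : ℂ :=
  ((1 - (k : ℂ)⁻¹ * z⁻¹) / (1 - (k : ℂ)⁻¹ * z)) ^ (1 / 2 : ℂ)

/-- `ψ(z) = (φ(z) z - d) / (z - c)`. Its value at the single point `z = c`, where the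
singularity is removable if `d = φ(c) c`, does not affect the Fourier coefficients. -/
def psi (k : ℝ) (c d z : ℂ) : ℂ :=
  (isingSymbol k z * z - d) / (z - c)

end BorderedToeplitz

end

open MeasureTheory Filter Topology Set

noncomputable section

namespace BorderedToeplitz

/-! Put q = 1/k and r(z) = (1 - qz)^{1/2}. On the circle φ(z) = r(1/z)/r(z), a Wiener-Hopf
factorisation. Let x be the first row of T_N(φ)⁻¹, so that F_N = ∑ x_i [ψ]_i, and let X(z) = ∑ x_i
z^{-i}. The coefficients of Xφ at 0, -1, …, -(N-1) are 1, 0, …, 0, so Xφ = U(z) + z^{-N} L(1/z) with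
power series U, L and U(0) = 1. Multiplying by r(z) gives X(z) r(1/z), which has no positive powers;
multiplying by 1/r(1/z) gives X(z)/r(z), which has no powers ≤ -N. These two facts couple U and L.

The Taylor coefficients of (1-w)^{-1/2} are the moments α_n of the arcsine law μ on [0,1], and those
of (1-w)^{1/2}, after the first, are minus the moments of (1-t)μ. Tails of convolutions thus become
integrals (`upper_equation`, `lower_equation`): r(c) U(c) = 1 + qc ∫ (qt)^N (1-t) L(qt)/(1-cqt) dμ,
L(s)/r(s) = -∫ (qt)^N U(qt)/(1-sqt) dμ. Each equation carries a factor q^N, so for large N their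
composition is a contraction. With 0 in place of 1 this shows that T_N(φ) is injective on row
vectors (`eq_zero_of_system`); otherwise it gives U = 1/r + O(q^{2N}) on [0,q].

For n ≥ 0 also [φ]_n = ∫ (qt)^n r(qt) dμ and [ψ]_n = ∫ (qt)^n r(qt)/(1-cqt) dμ (`coeff_psi`; d drops
out). Hence F_N = U(c) for |c| < 1, and the identity theorem extends the formula for U(c) to all c
off the ray (`sum_cauchyTransform_eq`). The leading term is 1/r(c). In the correction t^N
concentrates the integrals at t = 1, each extra factor 1-t costing O(1/N); its size is q^{2N}
α_N²/(2N+2), which Wallis turns into q^{2N}/(2πN²) (1 + O(1/N)). -/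

lemma hasSum_of_eq {ι : Type*} {f g : ι → ℂ} {a b : ℂ} (h : HasSum f a) (e : ∀ n, g n = f n)
    (e' : b = a) : HasSum g b := by
  rw [e', funext e]; exact h

/-! ### The arcsine law, its moments and the binomial series of exponent ±1/2 -/

/-- The arcsine law: the law of `sin² θ` for `θ` uniform on `(0, π]`. -/
def arcsine : Measure ℝ :=
  (ProbabilityTheory.cond volume (Ioc 0 Real.pi)).map fun θ => Real.sin θ ^ 2

lemma measurable_sin_sq : Measurable fun θ : ℝ => Real.sin θ ^ 2 := by fun_prop

instance : IsProbabilityMeasure arcsine := by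
  have : IsProbabilityMeasure (ProbabilityTheory.cond volume (Ioc 0 Real.pi)) :=
    ProbabilityTheory.cond_isProbabilityMeasure_of_finite
      (by simp [Real.pi_pos]) (by simp)
  exact Measure.isProbabilityMeasure_map measurable_sin_sq.aemeasurable

lemma arcsine_ae_mem : ∀ᵐ x ∂arcsine, x ∈ Icc (0 : ℝ) 1 := by
  refine (ae_map_iff measurable_sin_sq.aemeasurable
    (measurableSet_Icc (a := (0 : ℝ)) (b := 1))).2 ?_
  exact Eventually.of_forall fun θ => ⟨sq_nonneg _, Real.sin_sq_le_one θ⟩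

lemma restrict_arcsine : arcsine.restrict (Icc 0 1) = arcsine :=
  Measure.restrict_eq_self_of_ae_mem arcsine_ae_mem

lemma integrable_arcsine {E : Type*} [NormedAddCommGroup E] {h : ℝ → E}
    (hh : ContinuousOn h (Icc 0 1)) : Integrable h arcsine := by
  rw [← restrict_arcsine]
  exact hh.integrableOn_compact isCompact_Icc

lemma integral_arcsine_congr {E : Type*} [NormedAddCommGroup E] [NormedSpace ℝ E] {h h' : ℝ → E}
    (hh : ∀ x ∈ Icc (0 : ℝ) 1, h x = h' x) : ∫ x, h x ∂arcsine = ∫ x, h' x ∂arcsine :=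
  integral_congr_ae (arcsine_ae_mem.mono hh)

lemma norm_integral_arcsine_le {E : Type*} [NormedAddCommGroup E] [NormedSpace ℝ E]
    {h : ℝ → E} {b : ℝ → ℝ} (hb : ContinuousOn b (Icc 0 1))
    (hh : ∀ x ∈ Icc (0 : ℝ) 1, ‖h x‖ ≤ b x) : ‖∫ x, h x ∂arcsine‖ ≤ ∫ x, b x ∂arcsine :=
  norm_integral_le_of_norm_le (integrable_arcsine hb) (arcsine_ae_mem.mono hh)

lemma hasSum_integral_arcsine {h : ℕ → ℝ → ℂ} {H : ℝ → ℂ} {b : ℕ → ℝ}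
    (hc : ∀ n, ContinuousOn (h n) (Icc 0 1)) (hb : Summable b)
    (hhb : ∀ n, ∀ x ∈ Icc (0 : ℝ) 1, ‖h n x‖ ≤ b n)
    (hs : ∀ x ∈ Icc (0 : ℝ) 1, HasSum (fun n => h n x) (H x)) :
    HasSum (fun n => ∫ x, h n x ∂arcsine) (∫ x, H x ∂arcsine) := by
  refine hasSum_integral_of_dominated_convergence (fun n _ => b n)
    (fun n => (integrable_arcsine (hc n)).aestronglyMeasurable)
    (fun n => arcsine_ae_mem.mono (hhb n)) (Eventually.of_forall fun _ => hb)
    (integrable_const _) (arcsine_ae_mem.mono hs)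

/-- The moments of the arcsine law, `4⁻ⁿ (2n choose n)`. -/
def moment (n : ℕ) : ℝ := ∏ i ∈ Finset.range n, ((2 * (i : ℝ) + 1) / (2 * i + 2))

lemma moment_zero : moment 0 = 1 := by simp [moment]

lemma moment_succ (n : ℕ) : moment (n + 1) = moment n * ((2 * (n : ℝ) + 1) / (2 * n + 2)) := by
  rw [moment, Finset.prod_range_succ, moment]

lemma moment_pos (n : ℕ) : 0 < moment n := Finset.prod_pos fun i _ => by positivity

lemma moment_le_one (n : ℕ) : moment n ≤ 1 :=
  Finset.prod_le_one (fun i _ => by positivity) fun i _ => by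
    rw [div_le_one (by positivity)]; linarith

lemma integral_pow_arcsine (n : ℕ) : ∫ x, x ^ n ∂arcsine = moment n := by
  rw [arcsine, integral_map measurable_sin_sq.aemeasurable (by fun_prop),
    ProbabilityTheory.cond, integral_smul_measure]
  have := integral_sin_pow_even n
  rw [intervalIntegral.integral_of_le Real.pi_pos.le] at this
  simp only [← pow_mul, this, moment]
  simp [Real.pi_pos.le, Real.pi_ne_zero]

lemma integral_pow_arcsine_complex (n : ℕ) : ∫ x : ℝ, (x : ℂ) ^ n ∂arcsine = moment n := by
  rw [← integral_pow_arcsine, ← integral_complex_ofReal]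
  simp

lemma moment_sub_succ (n : ℕ) : moment n - moment (n + 1) = moment n / (2 * n + 2) := by
  rw [moment_succ]; field_simp; ring

lemma integral_pow_mul_one_sub (n : ℕ) :
    ∫ x, x ^ n * (1 - x) ∂arcsine = moment n / (2 * n + 2) := by
  rw [← moment_sub_succ, ← integral_pow_arcsine, ← integral_pow_arcsine, ← integral_sub
    (integrable_arcsine (by fun_prop)) (integrable_arcsine (by fun_prop))]
  congr 1; ext x; ring

lemma integral_pow_mul_one_sub_sq (n : ℕ) :
    ∫ x, x ^ n * (1 - x) ^ 2 ∂arcsine = 3 * moment n / ((2 * n + 2) * (2 * n + 4)) := by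
  have h1 : ∫ x, x ^ n * (1 - x) ^ 2 ∂arcsine =
      ∫ x, x ^ n * (1 - x) ∂arcsine - ∫ x, x ^ (n + 1) * (1 - x) ∂arcsine := by
    rw [← integral_sub (integrable_arcsine (by fun_prop)) (integrable_arcsine (by fun_prop))]
    congr 1; ext x; ring
  rw [h1, integral_pow_mul_one_sub, integral_pow_mul_one_sub, moment_succ]
  push_cast
  field_simp
  ring

/-- Links the moments to the Wallis products, which tend to π/2; this is the source of the constant
π in the final formula. -/
lemma moment_sq (n : ℕ) : moment n ^ 2 * ((2 * n + 1) * Real.Wallis.W n) = 1 := by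
  induction n with
  | zero => simp [moment, Real.Wallis.W]
  | succ n ih =>
    rw [moment_succ, Real.Wallis.W_succ]
    refine Eq.trans ?_ ih
    push_cast
    field_simp
    ring

/-- `n`-th Taylor coefficient of `(1 - x)^{1/2}`. -/
def sqrtCoeff : ℕ → ℝ
  | 0 => 1
  | n + 1 => moment (n + 1) - moment n

lemma sqrtCoeff_zero : sqrtCoeff 0 = 1 := rfl

lemma sqrtCoeff_succ (n : ℕ) : sqrtCoeff (n + 1) = moment (n + 1) - moment n := rfl

lemma abs_sqrtCoeff_le_one (n : ℕ) : |sqrtCoeff n| ≤ 1 := by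
  cases n with
  | zero => simp [sqrtCoeff]
  | succ n =>
    rw [sqrtCoeff_succ, abs_le]
    constructor <;> linarith [moment_pos n, moment_pos (n + 1), moment_le_one n,
      moment_le_one (n + 1)]

/-- Integrating against (1 - x) takes differences of consecutive moments. In this form convolutions
with the Taylor coefficients of the square root become Cauchy transforms. -/
lemma integral_pow_mul_one_sub_complex (n : ℕ) :
    ∫ x : ℝ, (x : ℂ) ^ n * (1 - x) ∂arcsine = -sqrtCoeff (n + 1) := by
  rw [sqrtCoeff_succ]
  have : -((moment (n + 1) - moment n : ℝ) : ℂ) = ((moment n / (2 * n + 2) : ℝ) : ℂ) := by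
    rw [← moment_sub_succ]; push_cast; ring
  rw [this, ← integral_pow_mul_one_sub, ← integral_complex_ofReal]
  simp

/-- Identifies the coefficients of the binomial series for exponent -1/2 with the arcsine moments,
both satisfying the same two-term recursion. -/
lemma choose_neg_half (n : ℕ) :
    Ring.choose (-1 / 2 : ℂ) n * (-1) ^ n = moment n := by
  induction n with
  | zero => simp [moment]
  | succ n ih =>
    have h : (n + 1 : ℂ) * Ring.choose (-1 / 2 : ℂ) (n + 1) =
        Ring.choose (-1 / 2 : ℂ) n * (-1 / 2 - n) := by
      have h1 := Ring.descPochhammer_eq_factorial_smul_choose (-1 / 2 : ℂ) n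
      have h2 := Ring.descPochhammer_eq_factorial_smul_choose (-1 / 2 : ℂ) (n + 1)
      rw [descPochhammer_succ_right, Polynomial.smeval_mul, h1] at h2
      simp only [Polynomial.smeval_sub, Polynomial.smeval_X, Polynomial.smeval_natCast,
        nsmul_eq_mul, pow_one, pow_zero, mul_one, Nat.factorial_succ, Nat.cast_mul,
        Nat.cast_succ] at h2
      have : (n.factorial : ℂ) ≠ 0 := by exact_mod_cast n.factorial_ne_zero
      apply mul_left_cancel₀ this
      linear_combination -h2
    have hn : (n + 1 : ℂ) ≠ 0 := by exact_mod_cast n.succ_ne_zero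
    have h3 : Ring.choose (-1 / 2 : ℂ) (n + 1) =
        Ring.choose (-1 / 2 : ℂ) n * (-1 / 2 - n) / (n + 1) := by
      rw [eq_div_iff hn, ← h]; ring
    rw [moment_succ, h3, Complex.ofReal_mul, ← ih]
    have : (2 * (n : ℂ) + 2) ≠ 0 := by
      rw [show (2 * (n : ℂ) + 2) = 2 * (n + 1) by ring]; exact mul_ne_zero two_ne_zero hn
    push_cast
    field_simp
    ring

/-- `(1 - q w)^{1/2}`. -/
def root (q : ℝ) (w : ℂ) : ℂ := (1 - q * w) ^ (1 / 2 : ℂ)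

lemma root_ne_zero {q : ℝ} {w : ℂ} (h : 1 - q * w ≠ 0) : root q w ≠ 0 := by
  simp [root, Complex.cpow_eq_zero_iff, h]

lemma root_mul_self (q : ℝ) (w : ℂ) : root q w * root q w = 1 - q * w := by
  rw [root, ← sq, ← Complex.cpow_nat_mul]; simp

lemma one_sub_mem_slitPlane {z : ℂ} (hz : ‖z‖ < 1) : 1 - z ∈ Complex.slitPlane := by
  rw [sub_eq_add_neg]
  exact Complex.mem_slitPlane_of_norm_lt_one (by simpa using hz)

lemma hasSum_inv_root {q : ℝ} {w : ℂ} (h : ‖q * w‖ < 1) :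
    HasSum (fun n : ℕ => (moment n : ℂ) * (q * w) ^ n) (root q w)⁻¹ := by
  have h0 := (Complex.one_add_cpow_hasFPowerSeriesOnBall_zero (a := -1 / 2)).hasSum
    (y := -(q * w)) (by
      rw [← ENNReal.ofReal_one, Metric.eball_ofReal]
      simpa using h)
  have e : (1 + (0 + -((q : ℂ) * w))) ^ (-1 / 2 : ℂ) = (root q w)⁻¹ := by
    rw [root, ← Complex.cpow_neg]; congr 1 <;> ring
  rw [e] at h0
  refine hasSum_of_eq h0 (fun n => ?_) rfl
  rw [binomialSeries_apply, ← choose_neg_half, List.ofFn_const, List.prod_replicate,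
    neg_pow (q * w), smul_eq_mul]
  ring

/-- Since (1 - qw)^{1/2} = (1 - qw)(1 - qw)^{-1/2}, the coefficients are differences of consecutive
moments. -/
lemma hasSum_root {q : ℝ} {w : ℂ} (h : ‖q * w‖ < 1) :
    HasSum (fun n : ℕ => (sqrtCoeff n : ℂ) * (q * w) ^ n) (root q w) := by
  have h0 := hasSum_inv_root h
  have h1 := (hasSum_nat_add_iff' 1).2 h0
  have hne : 1 - q * w ≠ 0 := Complex.slitPlane_ne_zero (one_sub_mem_slitPlane h)
  rw [← hasSum_nat_add_iff' 1]
  convert h1.sub (h0.mul_left (q * w)) using 1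
  · ext n
    rw [sqrtCoeff_succ]; push_cast; ring
  · have := root_mul_self q w
    have h2 := root_ne_zero hne
    have h3 : root q w = (1 - q * w) * (root q w)⁻¹ := by
      rw [← this]; field_simp
    simp only [Finset.sum_range_one, sqrtCoeff_zero, moment_zero, pow_zero, Complex.ofReal_one]
    linear_combination h3

lemma summable_moment_mul_pow {x : ℝ} (h0 : 0 ≤ x) (h1 : x < 1) :
    Summable fun n => moment n * x ^ n :=
  Summable.of_nonneg_of_le (fun n => mul_nonneg (moment_pos n).le (pow_nonneg h0 n))
    (fun n => mul_le_of_le_one_left (pow_nonneg h0 n) (moment_le_one n))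
    (summable_geometric_of_lt_one h0 h1)

lemma summable_abs_sqrtCoeff_mul_pow {x : ℝ} (h0 : 0 ≤ x) (h1 : x < 1) :
    Summable fun n => |sqrtCoeff n| * x ^ n :=
  Summable.of_nonneg_of_le (fun n => mul_nonneg (abs_nonneg _) (pow_nonneg h0 n))
    (fun n => mul_le_of_le_one_left (pow_nonneg h0 n) (abs_sqrtCoeff_le_one n))
    (summable_geometric_of_lt_one h0 h1)

/-! ### Cauchy transforms on the slit plane -/

/-- The complement of the ray `[1/q, ∞)`. -/
def slitDomain (q : ℝ) : Set ℂ := {c | 1 - q * c ∈ Complex.slitPlane}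

lemma isOpen_slitDomain (q : ℝ) : IsOpen (slitDomain q) :=
  Complex.isOpen_slitPlane.preimage (f := fun c : ℂ => 1 - q * c) (by fun_prop)

lemma mem_slitDomain_of_norm_lt {q : ℝ} {c : ℂ} (h : ‖q * c‖ < 1) : c ∈ slitDomain q :=
  one_sub_mem_slitPlane h

lemma zero_mem_slitDomain (q : ℝ) : (0 : ℂ) ∈ slitDomain q :=
  mem_slitDomain_of_norm_lt (by simp)

/-- The slit plane is star-shaped about 0. This yields both its connectedness and the nonvanishing
of the denominators 1 - cqx. -/
lemma mul_mem_slitDomain {q : ℝ} {c : ℂ} (hc : c ∈ slitDomain q) {t : ℝ} (ht : t ∈ Icc (0 : ℝ) 1) :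
    c * t ∈ slitDomain q := by
  simp only [slitDomain, mem_ofPred_eq, Complex.mem_slitPlane_iff] at hc ⊢
  simp only [Complex.sub_re, Complex.one_re, Complex.mul_re, Complex.ofReal_re, Complex.ofReal_im,
    Complex.sub_im, Complex.one_im, Complex.mul_im] at hc ⊢
  rcases ht.1.eq_or_lt with h | h
  · subst h; left; simp
  rcases hc with hc | hc
  · left
    have : 0 ≤ 1 - t := by linarith [ht.2]
    nlinarith [mul_pos h hc]
  · right
    contrapose! hc
    have : t * (0 - (q * c.im + 0 * c.re)) = 0 := by linarith
    exact (mul_eq_zero.1 this).resolve_left h.ne'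

lemma isPreconnected_slitDomain (q : ℝ) : IsPreconnected (slitDomain q) := by
  have : StarConvex ℝ (0 : ℂ) (slitDomain q) := by
    rw [starConvex_zero_iff]
    intro c hc t h0 h1
    rw [Complex.real_smul, mul_comm]
    exact mul_mem_slitDomain hc ⟨h0, h1⟩
  exact (this.isPathConnected (zero_mem_slitDomain q)).isConnected.isPreconnected

lemma one_sub_ne_zero {q : ℝ} {c : ℂ} (hc : c ∈ slitDomain q) {x : ℝ} (hx : x ∈ Icc (0 : ℝ) 1) :
    1 - c * (q * x) ≠ 0 := by
  have := Complex.slitPlane_ne_zero (mul_mem_slitDomain hc hx)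
  convert this using 2; ring

lemma differentiableOn_root (q : ℝ) : DifferentiableOn ℂ (root q) (slitDomain q) := by
  intro c hc
  have h : DifferentiableAt ℂ (fun w : ℂ => 1 - q * w) c := by fun_prop
  exact (h.cpow_const hc).differentiableWithinAt

lemma exists_lower_bound {q : ℝ} {c : ℂ} (hc : c ∈ slitDomain q) :
    ∃ δ > 0, ∀ x ∈ Icc (0 : ℝ) 1, δ ≤ ‖1 - c * (q * x)‖ := by
  obtain ⟨x₀, hx₀, h⟩ := isCompact_Icc.exists_isMinOn (nonempty_Icc.2 zero_le_one)
    (f := fun x : ℝ => ‖1 - c * (q * x)‖) (by fun_prop)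
  exact ⟨_, norm_pos_iff.2 (one_sub_ne_zero hc hx₀), fun x hx => h hx⟩

/-- The Cauchy-type transform of the density `h` against the arcsine law. -/
def cauchyTransform (q : ℝ) (h : ℝ → ℂ) (c : ℂ) : ℂ :=
  ∫ x, h x / (1 - c * (q * x)) ∂arcsine

lemma continuousOn_div_one_sub {q : ℝ} {h : ℝ → ℂ} (hh : ContinuousOn h (Icc 0 1)) {c : ℂ}
    (hc : c ∈ slitDomain q) : ContinuousOn (fun x : ℝ => h x / (1 - c * (q * x))) (Icc 0 1) :=
  hh.div (by fun_prop) fun _ hx => one_sub_ne_zero hc hx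

lemma differentiableOn_cauchyTransform {q : ℝ} (hq : |q| ≤ 1) {h : ℝ → ℂ}
    (hh : ContinuousOn h (Icc 0 1)) :
    DifferentiableOn ℂ (cauchyTransform q h) (slitDomain q) := by
  intro c hc
  obtain ⟨δ, hδ, hb⟩ := exists_lower_bound hc
  obtain ⟨M, hM⟩ := isCompact_Icc.exists_bound_of_continuousOn hh
  obtain ⟨r, hr, hball⟩ := Metric.isOpen_iff.1 (isOpen_slitDomain q) c hc
  -- Moving c by at most δ/2 moves 1 - cqx by at most δ/2, because |q|x ≤ 1; half of the lower bound
  -- survives, uniformly in x.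
  have hlow : ∀ z ∈ Metric.ball c (min r (δ / 2)), ∀ x ∈ Icc (0 : ℝ) 1,
      δ / 2 ≤ ‖1 - z * (q * x)‖ := by
    intro z hz x hx
    have h1 : ‖(z - c) * (q * x)‖ ≤ δ / 2 := by
      rw [norm_mul, ← Complex.ofReal_mul, Complex.norm_real, Real.norm_eq_abs, abs_mul,
        abs_of_nonneg hx.1]
      have h2 : ‖z - c‖ ≤ δ / 2 := by
        rw [← dist_eq_norm]; exact (hz.trans_le (min_le_right _ _)).le
      have h3 : |q| * x ≤ 1 := mul_le_one₀ hq hx.1 hx.2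
      have := mul_le_mul h2 h3 (mul_nonneg (abs_nonneg _) hx.1) (by positivity)
      linarith
    have h4 := norm_sub_norm_le (1 - c * (q * x)) ((z - c) * (q * x))
    have h5 : 1 - c * (q * x) - (z - c) * (q * x) = 1 - z * (q * (x : ℂ)) := by ring
    rw [h5] at h4
    linarith [hb x hx]
  have hsub : ∀ z ∈ Metric.ball c (min r (δ / 2)), z ∈ slitDomain q := fun z hz =>
    hball (Metric.ball_subset_ball (min_le_left _ _) hz)
  have hpos : 0 < min r (δ / 2) := lt_min hr (by positivity)
  refine (hasDerivAt_integral_of_dominated_loc_of_deriv_le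
    (F' := fun z x => h x * (q * x) / (1 - z * (q * x)) ^ 2)
    (bound := fun _ => M / (δ / 2) ^ 2) (Metric.ball_mem_nhds c hpos) ?_ ?_ ?_ ?_
    (integrable_const _) ?_).2.differentiableAt.differentiableWithinAt
  · filter_upwards [Metric.ball_mem_nhds c hpos] with z hz
    exact (integrable_arcsine (continuousOn_div_one_sub hh (hsub z hz))).aestronglyMeasurable
  · exact integrable_arcsine (continuousOn_div_one_sub hh hc)
  · refine (integrable_arcsine ?_).aestronglyMeasurable
    exact (hh.mul (by fun_prop)).div (by fun_prop)
      fun x hx => pow_ne_zero _ (one_sub_ne_zero hc hx)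
  · filter_upwards [arcsine_ae_mem] with x hx z hz
    rw [norm_div, norm_pow, norm_mul]
    have h1 : ‖(q : ℂ) * x‖ ≤ 1 := by
      rw [← Complex.ofReal_mul, Complex.norm_real, Real.norm_eq_abs, abs_mul, abs_of_nonneg hx.1]
      exact mul_le_one₀ hq hx.1 hx.2
    have h2 : ‖h x‖ * ‖(q : ℂ) * x‖ ≤ M :=
      (mul_le_of_le_one_right (norm_nonneg _) h1).trans (hM x hx)
    have h3 := hlow z hz x hx
    have hM0 : 0 ≤ M := (norm_nonneg _).trans (hM x hx)
    gcongr
  · filter_upwards [arcsine_ae_mem] with x hx z hz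
    have hne := one_sub_ne_zero (hsub z hz) hx
    have hd : HasDerivAt (fun z : ℂ => 1 - z * (q * x)) (-(q * x)) z := by
      simpa using ((hasDerivAt_id z).mul_const ((q : ℂ) * x)).const_sub 1
    have := (hasDerivAt_const z (h x)).div hd hne
    rwa [show (0 * (1 - z * (q * x)) - h x * -(q * x)) = h x * (q * x) by ring] at this

/-- The identity theorem: formulas checked by power series near 0 hold for every c off the ray. -/
lemma eqOn_slitDomain {q : ℝ} {F G : ℂ → ℂ} (hF : DifferentiableOn ℂ F (slitDomain q))
    (hG : DifferentiableOn ℂ G (slitDomain q)) (h : F =ᶠ[𝓝 0] G) : EqOn F G (slitDomain q) :=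
  (hF.analyticOnNhd (isOpen_slitDomain q)).eqOn_of_preconnected_of_eventuallyEq
    (hG.analyticOnNhd (isOpen_slitDomain q)) (isPreconnected_slitDomain q)
    (zero_mem_slitDomain q) h

/-- Power series expansion of the Cauchy transform. -/
lemma hasSum_cauchyTransform {q : ℝ} {h : ℝ → ℂ}
    (hh : ContinuousOn h (Icc 0 1)) {c : ℂ} (hc : ‖q * c‖ < 1) :
    HasSum (fun n => c ^ n * ∫ x : ℝ, (q * x) ^ n * h x ∂arcsine) (cauchyTransform q h c) := by
  obtain ⟨M, hM⟩ := isCompact_Icc.exists_bound_of_continuousOn hh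
  simp_rw [← integral_const_mul]
  have key : ∀ x ∈ Icc (0 : ℝ) 1, ‖c * (q * x)‖ ≤ ‖q * c‖ := by
    intro x hx
    rw [← mul_assoc, norm_mul, mul_comm c, Complex.norm_real, Real.norm_eq_abs,
      abs_of_nonneg hx.1]
    exact mul_le_of_le_one_right (norm_nonneg _) hx.2
  refine hasSum_integral_arcsine (b := fun n => ‖q * c‖ ^ n * M) (fun n => ?_)
    ((summable_geometric_of_lt_one (norm_nonneg _) hc).mul_right M) (fun n x hx => ?_)
    (fun x hx => ?_)
  · exact continuousOn_const.mul (ContinuousOn.mul (by fun_prop) hh)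
  · rw [← mul_assoc, ← mul_pow, norm_mul, norm_pow]
    exact mul_le_mul (pow_le_pow_left₀ (norm_nonneg _) (key x hx) n) (hM x hx) (norm_nonneg _)
      (by positivity)
  · have := (hasSum_geometric_of_norm_lt_one ((key x hx).trans_lt hc)).mul_left (h x)
    rw [div_eq_mul_inv]
    refine hasSum_of_eq this (fun n => ?_) rfl
    rw [mul_pow]
    ring

lemma cauchyTransform_one {q : ℝ} (hq : |q| ≤ 1) {c : ℂ} (hc : c ∈ slitDomain q) :
    cauchyTransform q (fun _ => 1) c = (root q c)⁻¹ := by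
  refine eqOn_slitDomain (differentiableOn_cauchyTransform hq continuousOn_const)
    ((differentiableOn_root q).inv fun z hz => root_ne_zero (Complex.slitPlane_ne_zero hz)) ?_ hc
  have : ∀ᶠ z : ℂ in 𝓝 0, ‖q * z‖ < 1 := by
    have : ContinuousAt (fun z : ℂ => ‖q * z‖) 0 := by fun_prop
    exact this.eventually_lt continuousAt_const (by simp)
  filter_upwards [this] with z hz
  refine (hasSum_cauchyTransform continuousOn_const hz).unique ?_
  rw [Pi.inv_apply]
  refine hasSum_of_eq (hasSum_inv_root hz) (fun n => ?_) rfl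
  simp_rw [mul_one, mul_pow]
  rw [integral_const_mul, integral_pow_arcsine_complex]
  ring

/-! ### Fourier coefficients of series on the circle -/

/-- The point `e^{iθ}` of the unit circle. -/
def circlePoint (θ : ℝ) : ℂ := Complex.exp (θ * Complex.I)

lemma norm_circlePoint (θ : ℝ) : ‖circlePoint θ‖ = 1 := Complex.norm_exp_ofReal_mul_I θ

lemma circlePoint_ne_zero (θ : ℝ) : circlePoint θ ≠ 0 := Complex.exp_ne_zero _

lemma continuous_circlePoint : Continuous circlePoint := by unfold circlePoint; fun_prop

/-- The Fourier coefficient does not see a single point of the circle. -/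
lemma coeff_congr_off_point {f g : ℂ → ℂ} (c : ℂ) (h : ∀ z, ‖z‖ = 1 → z ≠ c → f z = g z) (n : ℤ) :
    coeff f n = coeff g n := by
  unfold coeff
  congr 1
  have hcount : (circleMap 0 1 ⁻¹' {c}).Countable :=
    (Set.countable_singleton c).preimage_circleMap 0 one_ne_zero
  refine intervalIntegral.integral_congr_ae ?_
  filter_upwards [hcount.ae_notMem volume] with θ hθ _
  rw [h (Complex.exp (θ * Complex.I)) (norm_circlePoint θ)]
  intro he
  apply hθ
  simpa [circleMap] using he

lemma coeff_mul_zpow (a : ℂ) (e : ℤ) (g : ℂ → ℂ) (n : ℤ) :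
    coeff (fun z => a * z ^ e * g z) n = a * coeff g (n - e) := by
  unfold coeff
  rw [mul_left_comm a, ← intervalIntegral.integral_const_mul a]
  congr 1
  refine intervalIntegral.integral_congr (E := ℂ) fun θ _ => ?_
  beta_reduce
  rw [← Complex.exp_int_mul]
  have : Complex.exp (-((n - e : ℤ) * θ * Complex.I)) =
      Complex.exp (e * (θ * Complex.I)) * Complex.exp (-(n * θ * Complex.I)) := by
    rw [← Complex.exp_add]; congr 1; push_cast; ring
  rw [this]; ring

lemma coeff_add {f g : ℂ → ℂ} (hf : Continuous fun θ => f (circlePoint θ))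
    (hg : Continuous fun θ => g (circlePoint θ)) (n : ℤ) :
    coeff (fun z => f z + g z) n = coeff f n + coeff g n := by
  unfold coeff
  rw [← mul_add, ← intervalIntegral.integral_add]
  · simp only [add_mul]
  · exact (hf.mul (by fun_prop)).intervalIntegrable _ _
  · exact (hg.mul (by fun_prop)).intervalIntegrable _ _

lemma coeff_one (n : ℤ) : coeff (fun _ => 1) n = if n = 0 then 1 else 0 := by
  have hpi : (2 * (Real.pi : ℂ)) ≠ 0 := by simp [Real.pi_ne_zero]
  unfold coeff
  split_ifs with h
  · subst h
    simp only [Int.cast_zero, zero_mul, neg_zero, Complex.exp_zero, mul_one,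
      intervalIntegral.integral_const, sub_zero, Complex.real_smul, Complex.ofReal_mul,
      Complex.ofReal_ofNat]
    exact one_div_mul_cancel hpi
  · have hc : -((n : ℂ) * Complex.I) ≠ 0 := by simp [h]
    have := integral_exp_mul_complex (a := 0) (b := 2 * Real.pi) hc
    have e : ∀ θ : ℝ, (1 : ℂ) * Complex.exp (-(n * θ * Complex.I)) =
        Complex.exp (-((n : ℂ) * Complex.I) * θ) := by
      intro θ; rw [one_mul]; congr 1; ring
    simp_rw [e]
    rw [this]
    have h2 : Complex.exp (-((n : ℂ) * Complex.I) * (2 * Real.pi : ℝ)) = 1 := by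
      rw [Complex.exp_eq_one_iff]
      exact ⟨-n, by push_cast; ring⟩
    rw [h2]
    simp

lemma norm_coeff_le {f : ℂ → ℂ} {M : ℝ} (h : ∀ z, ‖z‖ = 1 → ‖f z‖ ≤ M) (n : ℤ) :
    ‖coeff f n‖ ≤ M := by
  unfold coeff
  have h1 := intervalIntegral.norm_integral_le_of_norm_le_const (a := 0) (b := 2 * Real.pi)
    (f := fun θ : ℝ => f (Complex.exp (θ * Complex.I)) * Complex.exp (-(n * θ * Complex.I)))
    (C := M) (fun θ _ => by
      have : ‖Complex.exp (-(n * θ * Complex.I))‖ = 1 := by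
        rw [show -((n : ℂ) * θ * Complex.I) = ((-(n * θ) : ℝ) : ℂ) * Complex.I by push_cast; ring]
        exact Complex.norm_exp_ofReal_mul_I _
      rw [norm_mul, this, mul_one]
      exact h _ (norm_circlePoint θ))
  rw [norm_mul]
  have h2 : ‖(1 / (2 * (Real.pi : ℂ)))‖ = 1 / (2 * Real.pi) := by
    simp [abs_of_pos Real.pi_pos]
  rw [h2, sub_zero, abs_of_pos (by positivity)] at *
  calc _ ≤ 1 / (2 * Real.pi) * (M * (2 * Real.pi)) := by gcongr
    _ = M := by field_simp

/-- One exceptional point c is allowed because ψ has an arbitrary value there. Replacing F by the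
sum of the series also removes any regularity assumption on F. -/
lemma hasSum_coeff {u : ℕ → ℂ → ℂ} {F : ℂ → ℂ} {b : ℕ → ℝ}
    (hu : ∀ l, Continuous fun θ => u l (circlePoint θ)) (hb : Summable b)
    (hub : ∀ l z, ‖z‖ = 1 → ‖u l z‖ ≤ b l) (c : ℂ)
    (hF : ∀ z, ‖z‖ = 1 → z ≠ c → HasSum (fun l => u l z) (F z)) (n : ℤ) :
    HasSum (fun l => coeff (u l) n) (coeff F n) := by
  have hS : ∀ z, ‖z‖ = 1 → HasSum (fun l => u l z) (∑' l, u l z) := fun z hz =>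
    (Summable.of_norm_bounded hb fun l => hub l z hz).hasSum
  rw [coeff_congr_off_point (g := fun z => ∑' l, u l z) c
    (fun z hz hzc => (hF z hz hzc).unique (hS z hz)) n]
  unfold coeff
  refine HasSum.mul_left _ (intervalIntegral.hasSum_integral_of_dominated_convergence
    (fun l _ => b l) (fun l => ?_) (fun l => ?_) ?_ ?_ ?_)
  · exact ((hu l).mul (by fun_prop)).aestronglyMeasurable
  · refine Eventually.of_forall fun θ _ => ?_
    have : ‖Complex.exp (-(n * θ * Complex.I))‖ = 1 := by
      rw [show -((n : ℂ) * θ * Complex.I) = ((-(n * θ) : ℝ) : ℂ) * Complex.I by push_cast; ring]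
      exact Complex.norm_exp_ofReal_mul_I _
    rw [norm_mul, this, mul_one]
    exact hub l _ (norm_circlePoint θ)
  · exact Eventually.of_forall fun _ _ => hb
  · exact intervalIntegrable_const
  · exact Eventually.of_forall fun θ _ => (hS _ (norm_circlePoint θ)).mul_right _

lemma norm_zpow_of_norm_eq_one {z : ℂ} (hz : ‖z‖ = 1) (e : ℤ) : ‖z ^ e‖ = 1 := by
  rw [norm_zpow, hz, one_zpow]

lemma continuous_circlePoint_zpow (e : ℤ) : Continuous fun θ => circlePoint θ ^ e :=
  continuous_circlePoint.zpow₀ e fun θ => Or.inl (circlePoint_ne_zero θ)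

/-- Fourier coefficients of the product of an absolutely convergent series with a function. -/
lemma hasSum_coeff_mul {a : ℕ → ℂ} (ha : Summable fun l => ‖a l‖) (e : ℕ → ℤ) {g F : ℂ → ℂ}
    (hg : Continuous fun θ => g (circlePoint θ)) {M : ℝ} (hM : ∀ z, ‖z‖ = 1 → ‖g z‖ ≤ M)
    (hF : ∀ z, ‖z‖ = 1 → HasSum (fun l => a l * z ^ e l * g z) (F z)) (n : ℤ) :
    HasSum (fun l => a l * coeff g (n - e l)) (coeff F n) := by
  have := hasSum_coeff (u := fun l z => a l * z ^ e l * g z) (b := fun l => ‖a l‖ * M)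
    (fun l => (continuous_const.mul (continuous_circlePoint_zpow _)).mul hg) (ha.mul_right M)
    (fun l z hz => by
      rw [norm_mul, norm_mul, norm_zpow_of_norm_eq_one hz, mul_one]
      exact mul_le_mul_of_nonneg_left (hM z hz) (norm_nonneg _)) 0 (fun z hz _ => hF z hz) n
  simpa only [coeff_mul_zpow] using this

lemma coeff_of_hasSum {a : ℕ → ℂ} (ha : Summable fun l => ‖a l‖) {e : ℕ → ℤ} {F : ℂ → ℂ}
    (hF : ∀ z, ‖z‖ = 1 → HasSum (fun l => a l * z ^ e l) (F z)) (n : ℤ) :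
    HasSum (fun l => if n = e l then a l else 0) (coeff F n) := by
  have := hasSum_coeff_mul ha e (g := fun _ => 1) (F := F) continuous_const (M := 1)
    (fun z _ => by simp) (fun z hz => by simpa using hF z hz) n
  refine hasSum_of_eq this (fun l => ?_) rfl
  simp [coeff_one, sub_eq_zero]

lemma coeff_of_hasSum_apply {a : ℕ → ℂ} (ha : Summable fun l => ‖a l‖) {e : ℕ → ℤ}
    (he : Function.Injective e) {F : ℂ → ℂ}
    (hF : ∀ z, ‖z‖ = 1 → HasSum (fun l => a l * z ^ e l) (F z)) (m : ℕ) :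
    coeff F (e m) = a m := by
  refine (coeff_of_hasSum ha hF (e m)).unique ?_
  simp_rw [he.eq_iff]
  refine hasSum_of_eq (hasSum_ite_eq m (a m)) (fun l => ?_) rfl
  by_cases h : l = m
  · subst h; simp
  · simp [h, Ne.symm h]

lemma coeff_of_hasSum_eq_zero {a : ℕ → ℂ} (ha : Summable fun l => ‖a l‖) {e : ℕ → ℤ}
    {F : ℂ → ℂ} (hF : ∀ z, ‖z‖ = 1 → HasSum (fun l => a l * z ^ e l) (F z)) {n : ℤ}
    (hn : ∀ l, n ≠ e l) : coeff F n = 0 := by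
  refine (coeff_of_hasSum ha hF n).unique ?_
  simp [hn]

/-! ### Factorisation and Fourier coefficients of the Ising symbol -/

section Ising

variable {q : ℝ} (h0 : 0 < q) (h1 : q < 1)
include h0 h1

lemma norm_mul_lt_one {z : ℂ} (hz : ‖z‖ ≤ 1) : ‖q * z‖ < 1 := by
  rw [norm_mul, Complex.norm_real, Real.norm_eq_abs, abs_of_pos h0]
  nlinarith [norm_nonneg z]

lemma mem_slitDomain_of_norm_le_one {z : ℂ} (hz : ‖z‖ ≤ 1) : z ∈ slitDomain q :=
  mem_slitDomain_of_norm_lt (norm_mul_lt_one h0 h1 hz)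

lemma continuous_root_comp {X : Type*} [TopologicalSpace X] {p : X → ℂ} (hp : Continuous p)
    (hp1 : ∀ x, ‖p x‖ ≤ 1) : Continuous fun x => root q (p x) :=
  (differentiableOn_root q).continuousOn.comp_continuous hp
    fun x => mem_slitDomain_of_norm_le_one h0 h1 (hp1 x)

lemma root_ne_zero_of_norm_le {z : ℂ} (hz : ‖z‖ ≤ 1) : root q z ≠ 0 :=
  root_ne_zero (Complex.slitPlane_ne_zero (mem_slitDomain_of_norm_le_one h0 h1 hz))

lemma summable_norm_moment : Summable fun l => ‖((moment l : ℂ) * q ^ l)‖ := by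
  refine (summable_moment_mul_pow h0.le h1).congr fun l => ?_
  rw [norm_mul, norm_pow, Complex.norm_real, Complex.norm_real, Real.norm_eq_abs, Real.norm_eq_abs,
    abs_of_pos (moment_pos l), abs_of_pos h0]

lemma summable_norm_sqrtCoeff : Summable fun l => ‖((sqrtCoeff l : ℂ) * q ^ l)‖ := by
  refine (summable_abs_sqrtCoeff_mul_pow h0.le h1).congr fun l => ?_
  rw [norm_mul, norm_pow, Complex.norm_real, Complex.norm_real, Real.norm_eq_abs, Real.norm_eq_abs,
    abs_of_pos h0]

lemma hasSum_inv_root' {z : ℂ} (hz : ‖z‖ ≤ 1) :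
    HasSum (fun n : ℕ => (moment n : ℂ) * q ^ n * z ^ n) (root q z)⁻¹ :=
  hasSum_of_eq (hasSum_inv_root (norm_mul_lt_one h0 h1 hz)) (fun n => by rw [mul_pow]; ring) rfl

lemma hasSum_root' {z : ℂ} (hz : ‖z‖ ≤ 1) :
    HasSum (fun n : ℕ => (sqrtCoeff n : ℂ) * q ^ n * z ^ n) (root q z) :=
  hasSum_of_eq (hasSum_root (norm_mul_lt_one h0 h1 hz)) (fun n => by rw [mul_pow]; ring) rfl

lemma coeff_inv_root_nat (n : ℕ) :
    coeff (fun z => (root q z)⁻¹) n = moment n * q ^ n :=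
  coeff_of_hasSum_apply (summable_norm_moment h0 h1) Nat.cast_injective
    (fun z hz => by simpa using hasSum_inv_root' h0 h1 hz.le) n

lemma coeff_inv_root_neg {n : ℤ} (hn : n < 0) : coeff (fun z => (root q z)⁻¹) n = 0 :=
  coeff_of_hasSum_eq_zero (summable_norm_moment h0 h1) (e := fun l => (l : ℤ))
    (fun z hz => by simpa using hasSum_inv_root' h0 h1 hz.le) fun l => by omega

lemma coeff_root_inv_neg_nat (n : ℕ) :
    coeff (fun z => root q z⁻¹) (-n) = sqrtCoeff n * q ^ n :=
  coeff_of_hasSum_apply (summable_norm_sqrtCoeff h0 h1) (e := fun l => -(l : ℤ))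
    (fun a b h => by simpa using h)
    (fun z hz => by simpa using hasSum_root' h0 h1 (z := z⁻¹) (by simp [hz])) n

lemma coeff_root_inv_pos {n : ℤ} (hn : 0 < n) : coeff (fun z => root q z⁻¹) n = 0 :=
  coeff_of_hasSum_eq_zero (summable_norm_sqrtCoeff h0 h1) (e := fun l => -(l : ℤ))
    (fun z hz => by simpa using hasSum_root' h0 h1 (z := z⁻¹) (by simp [hz])) fun l => by omega

/-- The principal root of a/b splits once |arg a - arg b| < π. For |z| ≥ 1, a has positive real
part, so |arg a| < π/2, while arg a and -arg b share the sign of Im z. That bounds the difference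
only by 3π/2; its sine also has the sign of Im z, which excludes [π, 3π/2). -/
lemma isingSymbol_eq {z : ℂ} (hz : 1 ≤ ‖z‖) (hzq : z ∈ slitDomain q) :
    isingSymbol q⁻¹ z = root q z⁻¹ * (root q z)⁻¹ := by
  have hz0 : z ≠ 0 := norm_pos_iff.1 (by linarith)
  have hw : ‖z⁻¹‖ ≤ 1 := by rw [norm_inv]; exact inv_le_one_of_one_le₀ hz
  set a : ℂ := 1 - q * z⁻¹ with ha
  set b : ℂ := 1 - q * z with hb
  have ha0 : a ≠ 0 := Complex.slitPlane_ne_zero (mem_slitDomain_of_norm_le_one h0 h1 hw)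
  have hb0 : b ≠ 0 := Complex.slitPlane_ne_zero hzq
  have hare : 0 < a.re := by
    have := Complex.re_le_norm (q * z⁻¹)
    have := norm_mul_lt_one h0 h1 hw
    simp only [ha, Complex.sub_re, Complex.one_re]
    linarith
  have hna : Complex.normSq z > 0 := Complex.normSq_pos.2 hz0
  have haim : a.im = q * z.im / Complex.normSq z := by
    simp [ha, Complex.inv_im]; ring
  have hare' : a.re = 1 - q * z.re / Complex.normSq z := by
    simp [ha, Complex.inv_re]; ring
  have hbim : b.im = -(q * z.im) := by simp [hb]
  have hbre : b.re = 1 - q * z.re := by simp [hb]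
  -- The last factor is at least (Re z - q)² + (Im z)² + 1 - q², hence positive.
  have hcross : a.im * b.re - a.re * b.im =
      q * z.im / Complex.normSq z * (1 + Complex.normSq z - 2 * q * z.re) := by
    rw [haim, hare', hbim, hbre]; field_simp; ring
  have hfac : 0 < 1 + Complex.normSq z - 2 * q * z.re := by
    rw [Complex.normSq_apply]
    nlinarith [sq_nonneg (z.re - q), mul_self_nonneg z.im]
  have hsin : Real.sin (a.arg - b.arg) * (‖a‖ * ‖b‖) = a.im * b.re - a.re * b.im := by
    rw [Real.sin_sub, Complex.sin_arg, Complex.sin_arg, Complex.cos_arg ha0, Complex.cos_arg hb0]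
    field_simp [norm_ne_zero_iff.2 ha0, norm_ne_zero_iff.2 hb0]
  have hab : 0 < ‖a‖ * ‖b‖ := mul_pos (norm_pos_iff.2 ha0) (norm_pos_iff.2 hb0)
  have harg : |a.arg| < Real.pi / 2 := Complex.abs_arg_lt_pi_div_two_iff.2 (Or.inl hare)
  rw [abs_lt] at harg
  have hbarg := Complex.arg_le_pi b
  have hbarg' := Complex.neg_pi_lt_arg b
  have hpi := Real.pi_pos
  have hbne : b.arg ≠ Real.pi := Complex.slitPlane_arg_ne_pi hzq
  have hrange : -Real.pi < a.arg - b.arg ∧ a.arg - b.arg < Real.pi := by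
    rcases lt_trichotomy z.im 0 with him | him | him
    · have h3 : a.arg ≤ 0 := by
        rw [← not_lt]; intro hh
        have : 0 ≤ a.im := Complex.arg_nonneg_iff.1 hh.le
        rw [haim] at this
        have : q * z.im / Complex.normSq z < 0 := div_neg_of_neg_of_pos (by nlinarith) hna
        linarith
      have h4 : 0 ≤ b.arg := Complex.arg_nonneg_iff.2 (by rw [hbim]; nlinarith)
      refine ⟨?_, by linarith⟩
      by_contra! hcon
      have h5 : 0 ≤ Real.sin (a.arg - b.arg) := by
        rw [← Real.sin_add_two_pi]
        exact Real.sin_nonneg_of_nonneg_of_le_pi (by linarith) (by linarith)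
      have h6 : q * z.im / Complex.normSq z < 0 := div_neg_of_neg_of_pos (by nlinarith) hna
      have := mul_nonneg h5 hab.le
      rw [hsin, hcross] at this
      nlinarith
    · have h3 : a.arg = 0 := Complex.arg_eq_zero_iff.2 ⟨hare.le, by rw [haim, him]; simp⟩
      have h4 : b.arg = 0 := by
        have hbi : b.im = 0 := by rw [hbim, him]; simp
        rcases Complex.mem_slitPlane_iff.1 hzq with h | h
        · exact Complex.arg_eq_zero_iff.2 ⟨h.le, hbi⟩
        · exact absurd hbi h
      rw [h3, h4]; constructor <;> linarith
    · have h3 : 0 ≤ a.arg := Complex.arg_nonneg_iff.2 (by rw [haim]; positivity)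
      have h4 : b.arg ≤ 0 := by
        rw [← not_lt]; intro hh
        have : 0 ≤ b.im := Complex.arg_nonneg_iff.1 hh.le
        rw [hbim] at this
        nlinarith
      refine ⟨by linarith, ?_⟩
      by_contra! hcon
      have h5 : Real.sin (a.arg - b.arg) ≤ 0 := by
        rw [← Real.sin_sub_two_pi]
        exact Real.sin_nonpos_of_nonpos_of_neg_pi_le (by linarith) (by linarith)
      have h6 : 0 < q * z.im / Complex.normSq z := by positivity
      have := mul_nonpos_of_nonpos_of_nonneg h5 hab.le
      rw [hsin, hcross] at this
      nlinarith
  have hlog : Complex.log (a / b) = Complex.log a - Complex.log b := by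
    rw [eq_comm, ← Complex.log_exp (x := Complex.log a - Complex.log b)]
    · rw [Complex.exp_sub, Complex.exp_log ha0, Complex.exp_log hb0]
    · simpa [Complex.log_im] using hrange.1
    · simpa [Complex.log_im] using hrange.2.le
  have e : isingSymbol q⁻¹ z = (a / b) ^ (1 / 2 : ℂ) := by
    simp [isingSymbol, ha, hb]
  rw [e, root, root, ← ha, ← hb, Complex.cpow_def_of_ne_zero (div_ne_zero ha0 hb0), hlog,
    Complex.cpow_def_of_ne_zero ha0, Complex.cpow_def_of_ne_zero hb0, sub_mul, Complex.exp_sub,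
    div_eq_mul_inv]

lemma isingSymbol_circle {z : ℂ} (hz : ‖z‖ = 1) :
    isingSymbol q⁻¹ z = root q z⁻¹ * (root q z)⁻¹ :=
  isingSymbol_eq h0 h1 hz.ge (mem_slitDomain_of_norm_le_one h0 h1 hz.le)

lemma continuous_root_inv_circlePoint : Continuous fun θ => root q (circlePoint θ)⁻¹ :=
  continuous_root_comp h0 h1 (continuous_circlePoint.inv₀ circlePoint_ne_zero)
    fun θ => by simp [norm_circlePoint]

lemma continuous_inv_root_circlePoint : Continuous fun θ => (root q (circlePoint θ))⁻¹ :=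
  (continuous_root_comp h0 h1 continuous_circlePoint fun θ => by simp [norm_circlePoint]).inv₀
    fun θ => root_ne_zero_of_norm_le h0 h1 (by simp [norm_circlePoint])

lemma continuous_isingSymbol : Continuous fun θ => isingSymbol q⁻¹ (circlePoint θ) := by
  simp_rw [isingSymbol_circle h0 h1 (norm_circlePoint _)]
  exact (continuous_root_inv_circlePoint h0 h1).mul (continuous_inv_root_circlePoint h0 h1)

omit h0 h1 in
lemma norm_root_inv_eq {z : ℂ} (hz : ‖z‖ = 1) : ‖root q z⁻¹‖ = ‖root q z‖ := by
  have h2 : ‖(1 - q * z⁻¹)‖ = ‖1 - q * z‖ := by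
    have : (1 - q * z⁻¹ : ℂ) = (starRingEnd ℂ) (1 - q * z) := by
      rw [Complex.inv_def, Complex.normSq_eq_norm_sq, hz]; simp
    rw [this, Complex.norm_conj]
  rw [← root_mul_self, ← root_mul_self, norm_mul, norm_mul] at h2
  exact (mul_self_inj (norm_nonneg _) (norm_nonneg _)).1 h2

lemma norm_isingSymbol {z : ℂ} (hz : ‖z‖ = 1) : ‖isingSymbol q⁻¹ z‖ = 1 := by
  rw [isingSymbol_circle h0 h1 hz, norm_mul, norm_inv, norm_root_inv_eq hz]
  exact mul_inv_cancel₀ (norm_ne_zero_iff.2 (root_ne_zero_of_norm_le h0 h1 hz.le))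

lemma norm_coeff_isingSymbol_le (n : ℤ) : ‖coeff (isingSymbol q⁻¹) n‖ ≤ 1 :=
  norm_coeff_le (fun _ hz => (norm_isingSymbol h0 h1 hz).le) n

/-- Multiplying φ by r(z) cancels its denominator and leaves r(1/z), a series in nonpositive powers.
-/
lemma hasSum_sqrtCoeff_mul_coeff_isingSymbol (n : ℤ) :
    HasSum (fun l : ℕ => (sqrtCoeff l : ℂ) * q ^ l * coeff (isingSymbol q⁻¹) (n - l))
      (coeff (fun z => root q z⁻¹) n) := by
  refine hasSum_coeff_mul (summable_norm_sqrtCoeff h0 h1) (fun l => (l : ℤ))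
    (continuous_isingSymbol h0 h1) (fun z hz => (norm_isingSymbol h0 h1 hz).le) (fun z hz => ?_) n
  refine hasSum_of_eq ((hasSum_root' h0 h1 hz.le).mul_right (isingSymbol q⁻¹ z)) (fun l => by simp) ?_
  rw [isingSymbol_circle h0 h1 hz]
  field_simp [root_ne_zero_of_norm_le h0 h1 hz.le]

/-- Dividing φ by r(1/z) leaves 1/r(z), a series in nonnegative powers. -/
lemma hasSum_moment_mul_coeff_isingSymbol (n : ℤ) :
    HasSum (fun l : ℕ => (moment l : ℂ) * q ^ l * coeff (isingSymbol q⁻¹) (n + l))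
      (coeff (fun z => (root q z)⁻¹) n) := by
  have hw : ∀ z : ℂ, ‖z‖ = 1 → ‖z⁻¹‖ ≤ 1 := fun z hz => by simp [hz]
  have := hasSum_coeff_mul (summable_norm_moment h0 h1) (fun l => -(l : ℤ))
    (continuous_isingSymbol h0 h1) (fun z hz => (norm_isingSymbol h0 h1 hz).le)
    (F := fun z => (root q z)⁻¹) (fun z hz => ?_) n
  · simpa using this
  refine hasSum_of_eq ((hasSum_inv_root' h0 h1 (hw z hz)).mul_right (isingSymbol q⁻¹ z)) (fun l => by simp) ?_
  rw [isingSymbol_circle h0 h1 hz]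
  field_simp [root_ne_zero_of_norm_le h0 h1 (hw z hz)]

lemma continuousOn_root_mul : ContinuousOn (fun x : ℝ => root q (q * x)) (Icc 0 1) := by
  refine (differentiableOn_root q).continuousOn.comp (by fun_prop) fun x hx => ?_
  refine mem_slitDomain_of_norm_le_one h0 h1 (norm_mul_lt_one h0 h1 ?_).le
  rw [Complex.norm_real, Real.norm_eq_abs, abs_of_nonneg hx.1]; exact hx.2

omit h1 in
lemma norm_mul_ofReal_le {x : ℝ} (hx : x ∈ Icc (0 : ℝ) 1) : ‖(q : ℂ) * x‖ ≤ q := by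
  rw [norm_mul, Complex.norm_real, Complex.norm_real, Real.norm_eq_abs, Real.norm_eq_abs,
    abs_of_nonneg hx.1, abs_of_pos h0]
  exact mul_le_of_le_one_right h0.le hx.2

/-- Convolving the coefficients of r(1/z) with those of 1/r(z) produces the moments α_{n+l}; under
the integral the sum over l reassembles r(qx). -/
lemma coeff_isingSymbol_nat (n : ℕ) :
    coeff (isingSymbol q⁻¹) n = ∫ x : ℝ, (q * x : ℂ) ^ n * root q (q * x) ∂arcsine := by
  have hw : ∀ z : ℂ, ‖z‖ = 1 → ‖z⁻¹‖ ≤ 1 := fun z hz => by simp [hz]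
  have hcont := continuous_inv_root_circlePoint h0 h1
  have h2 : ∀ z : ℂ, ‖z‖ = 1 → ‖(root q z)⁻¹‖ ≤ ∑' l, ‖((moment l : ℂ) * q ^ l)‖ := by
    intro z hz
    rw [← (hasSum_inv_root' h0 h1 hz.le).tsum_eq]
    refine tsum_of_norm_bounded (summable_norm_moment h0 h1).hasSum fun l => ?_
    rw [norm_mul _ (z ^ l), norm_pow, hz, one_pow, mul_one]
  have h3 := hasSum_coeff_mul (summable_norm_sqrtCoeff h0 h1) (fun l => -(l : ℤ))
    hcont h2 (F := isingSymbol q⁻¹) (fun z hz => ?_) n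
  · refine h3.unique ?_
    have h4 := hasSum_integral_arcsine
      (h := fun l x => (sqrtCoeff l : ℂ) * q ^ l * (q * x) ^ (n + l))
      (H := fun x => (q * x : ℂ) ^ n * root q (q * x)) (fun l => by fun_prop)
      (summable_norm_sqrtCoeff h0 h1) (fun l x hx => ?_) (fun x hx => ?_)
    · refine hasSum_of_eq h4 (fun l => ?_) rfl
      rw [sub_neg_eq_add, ← Nat.cast_add, coeff_inv_root_nat h0 h1, integral_const_mul]
      simp_rw [mul_pow]
      rw [integral_const_mul, integral_pow_arcsine_complex]
      ring
    · rw [norm_mul _ ((q * x : ℂ) ^ (n + l)), norm_pow]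
      exact mul_le_of_le_one_right (norm_nonneg _)
        (pow_le_one₀ (norm_nonneg _) ((norm_mul_ofReal_le h0 hx).trans h1.le))
    · refine hasSum_of_eq ((hasSum_root' h0 h1
        ((norm_mul_ofReal_le h0 hx).trans h1.le)).mul_left ((q * x : ℂ) ^ n)) (fun l => ?_) rfl
      ring
  · refine hasSum_of_eq ((hasSum_root' h0 h1 (hw z hz)).mul_right (root q z)⁻¹) (fun l => by simp) ?_
    rw [isingSymbol_circle h0 h1 hz]

end Ising

/-! ### Divided differences of power series -/

/-- Coefficients of the divided difference `(P(w) - P(s)) / (w - s)` of `P(w) = ∑ p_l w^l`. -/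
def dividedCoeff (p : ℕ → ℂ) (s : ℂ) (r : ℕ) : ℂ := ∑' i, p (r + 1 + i) * s ^ i

section Divided

variable {p : ℕ → ℂ} {C ρ : ℝ} (hρ0 : 0 ≤ ρ) (hρ1 : ρ < 1) (hp : ∀ l, ‖p l‖ ≤ C * ρ ^ l)
include hρ0 hρ1 hp

omit hρ0 hρ1 in
lemma norm_dividedCoeff_term_le {s : ℂ} (hs : ‖s‖ ≤ 1) (r i : ℕ) :
    ‖p (r + 1 + i) * s ^ i‖ ≤ C * ρ ^ (r + 1) * ρ ^ i := by
  rw [norm_mul, norm_pow]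
  refine (mul_le_of_le_one_right (norm_nonneg _) (pow_le_one₀ (norm_nonneg _) hs)).trans ?_
  rw [mul_assoc, ← pow_add]
  exact hp _

lemma hasSum_dividedCoeff {s : ℂ} (hs : ‖s‖ ≤ 1) (r : ℕ) :
    HasSum (fun i => p (r + 1 + i) * s ^ i) (dividedCoeff p s r) :=
  (Summable.of_norm_bounded ((summable_geometric_of_lt_one hρ0 hρ1).mul_left _)
    (norm_dividedCoeff_term_le hp hs r)).hasSum

lemma norm_dividedCoeff_le {s : ℂ} (hs : ‖s‖ ≤ 1) (r : ℕ) :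
    ‖dividedCoeff p s r‖ ≤ C * ρ ^ (r + 1) * (1 - ρ)⁻¹ :=
  tsum_of_norm_bounded ((hasSum_geometric_of_lt_one hρ0 hρ1).mul_left _)
    (norm_dividedCoeff_term_le hp hs r)

lemma dividedCoeff_eq {s : ℂ} (hs : ‖s‖ ≤ 1) (r : ℕ) :
    dividedCoeff p s r = p (r + 1) + s * dividedCoeff p s (r + 1) := by
  have h1 := (hasSum_nat_add_iff' 1).2 (hasSum_dividedCoeff hρ0 hρ1 hp hs r)
  have h2 := (hasSum_dividedCoeff hρ0 hρ1 hp hs (r + 1)).mul_left s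
  have := h1.unique (hasSum_of_eq h2 (fun i => ?_) rfl)
  · simp at this
    linear_combination this
  · rw [show r + 1 + (i + 1) = r + 1 + 1 + i by ring]; ring

lemma summable_norm_dividedCoeff {s : ℂ} (hs : ‖s‖ ≤ 1) :
    Summable fun r => ‖dividedCoeff p s r‖ := by
  refine Summable.of_nonneg_of_le (fun _ => norm_nonneg _) (norm_dividedCoeff_le hρ0 hρ1 hp hs) ?_
  exact (((summable_nat_add_iff 1).2 (summable_geometric_of_lt_one hρ0 hρ1)).mul_left C).mul_right _

lemma hasSum_dividedCoeff_mul_pow {s w Ps Pw : ℂ} (hs : ‖s‖ ≤ 1) (hw : ‖w‖ ≤ 1) (hne : w ≠ s)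
    (hPs : HasSum (fun l => p l * s ^ l) Ps) (hPw : HasSum (fun l => p l * w ^ l) Pw) :
    HasSum (fun r => dividedCoeff p s r * w ^ r) ((Pw - Ps) / (w - s)) := by
  obtain ⟨G, hG⟩ : Summable fun r => dividedCoeff p s r * w ^ r := by
    refine Summable.of_norm_bounded (summable_norm_dividedCoeff hρ0 hρ1 hp hs) fun r => ?_
    rw [norm_mul, norm_pow]
    exact mul_le_of_le_one_right (norm_nonneg _) (pow_le_one₀ (norm_nonneg _) hw)
  have h0 : Ps = p 0 + s * dividedCoeff p s 0 := by
    have h1 := (hasSum_nat_add_iff' 1).2 hPs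
    have h2 := (hasSum_dividedCoeff hρ0 hρ1 hp hs 0).mul_left s
    have := h1.unique (hasSum_of_eq h2 (fun i => by rw [zero_add, add_comm 1 i]; ring) rfl)
    simp at this
    linear_combination this
  have hPw' := (hasSum_nat_add_iff' 1).2 hPw
  have h3 := (hG.mul_left w).sub hPw'
  have h4 := (hasSum_nat_add_iff' 1).2 (hG.mul_left s)
  have := h4.unique (hasSum_of_eq h3 (fun r => ?_) rfl)
  · have key : G = (Pw - Ps) / (w - s) := by
      rw [eq_div_iff (sub_ne_zero.2 hne)]
      simp at this
      linear_combination -this + h0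
    rwa [← key]
  · rw [dividedCoeff_eq hρ0 hρ1 hp hs r]; ring

end Divided

/-! ### Nonnegative Fourier coefficients of ψ -/

section Psi

variable {q : ℝ} (h0 : 0 < q) (h1 : q < 1)
include h0 h1

/-- Taylor coefficients of `(1 - q w)^{1/2}`. -/
def rootTaylor (q : ℝ) (l : ℕ) : ℂ := (sqrtCoeff l : ℂ) * q ^ l

omit h1 in
lemma norm_rootTaylor_le (l : ℕ) : ‖rootTaylor q l‖ ≤ 1 * q ^ l := by
  rw [rootTaylor, norm_mul, norm_pow, Complex.norm_real, Complex.norm_real, Real.norm_eq_abs,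
    Real.norm_eq_abs, abs_of_pos h0]
  exact mul_le_mul_of_nonneg_right (abs_sqrtCoeff_le_one l) (by positivity)

lemma continuousOn_dividedCoeff (r : ℕ) :
    ContinuousOn (fun x : ℝ => dividedCoeff (rootTaylor q) (q * x) r) (Icc 0 1) := by
  refine continuousOn_tsum (u := fun i => 1 * q ^ (r + 1) * q ^ i) (fun i => by fun_prop)
    ((summable_geometric_of_lt_one h0.le h1).mul_left _) fun i x hx => ?_
  exact norm_dividedCoeff_term_le (norm_rootTaylor_le h0)
    ((norm_mul_ofReal_le h0 hx).trans h1.le) r i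

/-- The part of the Ising symbol that is analytic off `[1/q, ∞)`. -/
def plusPart (q : ℝ) (z : ℂ) : ℂ := cauchyTransform q (fun x => root q (q * x)) z

/-- Laurent coefficients of the part of the Ising symbol that is analytic outside the disc. -/
def minusCoeff (q : ℝ) (r : ℕ) : ℂ := ∫ x : ℝ, dividedCoeff (rootTaylor q) (q * x) r ∂arcsine

lemma norm_minusCoeff_le (r : ℕ) : ‖minusCoeff q r‖ ≤ q * (1 - q)⁻¹ * q ^ r := by
  refine (norm_integral_arcsine_le (b := fun _ => q * (1 - q)⁻¹ * q ^ r) continuousOn_const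
    fun x hx => ?_).trans (by simp)
  refine (norm_dividedCoeff_le h0.le h1 (norm_rootTaylor_le h0)
    ((norm_mul_ofReal_le h0 hx).trans h1.le) r).trans (le_of_eq ?_)
  ring

/-- Writing 1/r(z) as ∫ 1/(1 - zqx) dμ turns z(φ - P), with P = `plusPart q`, into the average over
x of (r(w) - r(s))/(w - s), w = 1/z, s = qx: a power series in w. -/
lemma hasSum_minusCoeff {z : ℂ} (hz : 1 ≤ ‖z‖) (hzq : z ∈ slitDomain q) :
    HasSum (fun r => minusCoeff q r * z⁻¹ ^ r) (z * (isingSymbol q⁻¹ z - plusPart q z)) := by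
  have hz0 : z ≠ 0 := norm_pos_iff.1 (by linarith)
  have hw : ‖z⁻¹‖ ≤ 1 := by rw [norm_inv]; exact inv_le_one_of_one_le₀ hz
  have hcont := continuousOn_root_mul h0 h1
  have h2 := hasSum_integral_arcsine
    (h := fun r x => dividedCoeff (rootTaylor q) (q * x) r * z⁻¹ ^ r)
    (H := fun x => z * (root q z⁻¹ * (1 / (1 - z * (q * x))) - root q (q * x) / (1 - z * (q * x))))
    (b := fun r => 1 * q ^ (r + 1) * (1 - q)⁻¹)
    (fun r => (continuousOn_dividedCoeff h0 h1 r).mul continuousOn_const)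
    (((summable_nat_add_iff 1).2 (summable_geometric_of_lt_one h0.le h1)).mul_left 1 |>.mul_right _)
    (fun r x hx => ?_) (fun x hx => ?_)
  · refine hasSum_of_eq h2 (fun r => ?_) ?_
    · rw [integral_mul_const, minusCoeff]
    · rw [integral_const_mul, integral_sub, integral_const_mul,
        isingSymbol_eq h0 h1 hz hzq, ← cauchyTransform_one (by rw [abs_of_pos h0]; exact h1.le) hzq]
      · rfl
      · exact (integrable_arcsine (continuousOn_div_one_sub continuousOn_const hzq)).const_mul _
      · exact integrable_arcsine (continuousOn_div_one_sub hcont hzq)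
  · have hs := (norm_mul_ofReal_le h0 hx).trans h1.le
    rw [norm_mul, norm_pow]
    refine (mul_le_of_le_one_right (norm_nonneg _) (pow_le_one₀ (norm_nonneg _) hw)).trans ?_
    exact norm_dividedCoeff_le h0.le h1 (norm_rootTaylor_le h0) hs r
  · have hs := (norm_mul_ofReal_le h0 hx).trans h1.le
    have hne := one_sub_ne_zero hzq hx
    have hne' : z⁻¹ - q * x ≠ 0 := by
      intro h
      apply hne
      rw [← sub_eq_zero.1 h, mul_inv_cancel₀ hz0, sub_self]
    refine hasSum_of_eq (hasSum_dividedCoeff_mul_pow h0.le h1 (norm_rootTaylor_le h0) hs hw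
      (sub_ne_zero.1 hne') (hasSum_root' h0 h1 hs) (hasSum_root' h0 h1 hw)) (fun _ => rfl) ?_
    have : (1 - z * (q * x)) = z * (z⁻¹ - q * x) := by
      rw [mul_sub, mul_inv_cancel₀ hz0]
    rw [this]
    field_simp

/-- `ψ` minus its analytic part is, on the circle, a series of negative powers. -/
lemma exists_negative_series {c d : ℂ} (hc : c ∈ slitDomain q)
    (hd : 1 ≤ ‖c‖ → d = isingSymbol q⁻¹ c * c) :
    ∃ r : ℕ → ℂ, (Summable fun m => ‖r m‖) ∧ ∀ z : ℂ, ‖z‖ = 1 → z ≠ c →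
      HasSum (fun m : ℕ => r m * z⁻¹ ^ (m + 1))
        ((c * plusPart q c - d + z * (isingSymbol q⁻¹ z - plusPart q z)) / (z - c)) := by
  set D : ℂ := c * plusPart q c - d with hD
  set p : ℕ → ℂ := fun l => minusCoeff q l + if l = 0 then D else 0 with hpdef
  have hp : ∀ l, ‖p l‖ ≤ (q * (1 - q)⁻¹ + ‖D‖) * q ^ l := by
    intro l
    refine (norm_add_le _ _).trans ?_
    rw [add_mul]
    refine add_le_add (norm_minusCoeff_le h0 h1 l) ?_
    split_ifs with h
    · simp [h]
    · simp; positivity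
  have hP : ∀ z : ℂ, 1 ≤ ‖z‖ → z ∈ slitDomain q →
      HasSum (fun l => p l * z⁻¹ ^ l) (D + z * (isingSymbol q⁻¹ z - plusPart q z)) := by
    intro z hz hzq
    have h2 := (hasSum_minusCoeff h0 h1 hz hzq).add (hasSum_ite_eq 0 D)
    refine hasSum_of_eq h2 (fun l => ?_) (add_comm _ _)
    by_cases h : l = 0 <;> simp [hpdef, h]
  have hmem : ∀ z : ℂ, ‖z‖ = 1 → z ∈ slitDomain q := fun z hz =>
    mem_slitDomain_of_norm_le_one h0 h1 hz.le
  -- For |c| < 1, 1/(z - c) is itself a series in negative powers, whatever d is. For |c| ≥ 1 the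
  -- numerator, a power series in 1/z, must vanish at c; the prescribed d ensures this, and a
  -- divided difference performs the division.
  rcases lt_or_ge ‖c‖ 1 with hc1 | hc1
  · have hsp : Summable fun l => ‖p l‖ := Summable.of_nonneg_of_le (fun _ => norm_nonneg _) hp
      ((summable_geometric_of_lt_one h0.le h1).mul_left _)
    have hsc : Summable fun l => ‖c ^ l‖ := by
      simp_rw [norm_pow]; exact summable_geometric_of_lt_one (norm_nonneg _) hc1
    refine ⟨fun m => ∑ kl ∈ Finset.HasAntidiagonal.antidiagonal m, p kl.1 * c ^ kl.2,
      summable_norm_sum_mul_antidiagonal_of_summable_norm hsp hsc, fun z hz hzc => ?_⟩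
    have hz0 : z ≠ 0 := norm_pos_iff.1 (by linarith)
    have hzi : ‖z⁻¹‖ = 1 := by simp [hz]
    have hcz : ‖c * z⁻¹‖ < 1 := by rw [norm_mul, hzi, mul_one]; exact hc1
    have hA : Summable fun l => ‖p l * z⁻¹ ^ l‖ := by
      refine hsp.congr fun l => ?_
      rw [norm_mul, norm_pow, hzi, one_pow, mul_one]
    have hB : Summable fun l => ‖(c * z⁻¹) ^ l‖ := by
      simp_rw [norm_pow]; exact summable_geometric_of_lt_one (norm_nonneg _) hcz
    have h2 := (summable_norm_sum_mul_antidiagonal_of_summable_norm hA hB).of_norm.hasSum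
    rw [← tsum_mul_tsum_eq_tsum_sum_antidiagonal_of_summable_norm hA hB,
      (hP z hz.ge (hmem z hz)).tsum_eq, tsum_geometric_of_norm_lt_one hcz] at h2
    refine hasSum_of_eq (h2.mul_right z⁻¹) (fun m => ?_) ?_
    · rw [Finset.sum_mul, Finset.sum_mul]
      refine Finset.sum_congr rfl fun kl hkl => ?_
      rw [← Finset.HasAntidiagonal.mem_antidiagonal.1 hkl, mul_pow]
      ring
    · have h3 : (1 - c * z⁻¹) = (z - c) * z⁻¹ := by field_simp
      have h4 : z - c ≠ 0 := sub_ne_zero.2 hzc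
      rw [h3]
      field_simp
  · have hc0 : c ≠ 0 := norm_pos_iff.1 (by linarith)
    have hs : ‖c⁻¹‖ ≤ 1 := by rw [norm_inv]; exact inv_le_one_of_one_le₀ hc1
    refine ⟨fun m => -c⁻¹ * dividedCoeff p c⁻¹ m, ?_, fun z hz hzc => ?_⟩
    · simp_rw [norm_mul]
      exact (summable_norm_dividedCoeff h0.le h1 hp hs).mul_left _
    · have hz0 : z ≠ 0 := norm_pos_iff.1 (by linarith)
      have hne : z⁻¹ ≠ c⁻¹ := fun h => hzc (inv_injective h)
      have h2 := hasSum_dividedCoeff_mul_pow h0.le h1 hp hs (w := z⁻¹) (by simp [hz]) hne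
        (hP c hc1 hc) (hP z hz.ge (hmem z hz))
      refine hasSum_of_eq (h2.mul_left (-c⁻¹ * z⁻¹)) (fun m => by ring) ?_
      have h3 : D + c * (isingSymbol q⁻¹ c - plusPart q c) = 0 := by rw [hD, hd hc1]; ring
      have h4 : z⁻¹ - c⁻¹ = -(c⁻¹ * z⁻¹) * (z - c) := by field_simp; ring
      have h5 : z - c ≠ 0 := sub_ne_zero.2 hzc
      rw [h3, h4]
      field_simp
      ring

omit h1 in
lemma norm_integral_pow_mul_le {h : ℝ → ℂ} {M : ℝ} (hM : ∀ x ∈ Icc (0 : ℝ) 1, ‖h x‖ ≤ M) (n : ℕ) :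
    ‖∫ x : ℝ, (q * x : ℂ) ^ n * h x ∂arcsine‖ ≤ q ^ n * M := by
  refine (norm_integral_arcsine_le (b := fun _ => q ^ n * M) continuousOn_const
    fun x hx => ?_).trans (by simp)
  rw [norm_mul, norm_pow]
  exact mul_le_mul (pow_le_pow_left₀ (norm_nonneg _) (norm_mul_ofReal_le h0 hx) n) (hM x hx)
    (norm_nonneg _) (by positivity)

/-- With P = `plusPart q`, ψ is (zP(z) - cP(c))/(z - c) plus a series in negative powers. The first
summand is the Cauchy transform of r(qx)/(1 - cqx), whose Taylor coefficients are the required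
integrals. -/
lemma coeff_psi {c d : ℂ} (hc : c ∈ slitDomain q)
    (hd : 1 ≤ ‖c‖ → d = isingSymbol q⁻¹ c * c) (n : ℕ) :
    coeff (psi q⁻¹ c d) n =
      cauchyTransform q (fun x => (q * x : ℂ) ^ n * root q (q * x)) c := by
  obtain ⟨r, hr, hrs⟩ := exists_negative_series h0 h1 hc hd
  have hcont := continuousOn_root_mul h0 h1
  set h : ℝ → ℂ := fun x => root q (q * x) / (1 - c * (q * x)) with hh
  have hhc : ContinuousOn h (Icc 0 1) := continuousOn_div_one_sub hcont hc
  obtain ⟨M, hM⟩ := isCompact_Icc.exists_bound_of_continuousOn hhc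
  set a : ℕ → ℂ := fun l => ∫ x : ℝ, (q * x : ℂ) ^ l * h x ∂arcsine with ha
  have hab := norm_integral_pow_mul_le h0 hM
  have key := hasSum_coeff (u := fun l z => a l * z ^ (l : ℤ) * 1 + r l * z ^ (-(l + 1 : ℤ)) * 1)
    (F := psi q⁻¹ c d) (b := fun l => q ^ l * M + ‖r l‖)
    (fun l => ((continuous_const.mul (continuous_circlePoint_zpow _)).mul continuous_const).add
      ((continuous_const.mul (continuous_circlePoint_zpow _)).mul continuous_const))
    (((summable_geometric_of_lt_one h0.le h1).mul_right M).add hr) (fun l z hz => ?_) c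
    (fun z hz hzc => ?_) n
  · have hval : ∀ l : ℕ, coeff (fun z => a l * z ^ (l : ℤ) * 1 + r l * z ^ (-(l + 1 : ℤ)) * 1) n =
        if l = n then a n else 0 := by
      intro l
      rw [coeff_add ((continuous_const.mul (continuous_circlePoint_zpow _)).mul continuous_const)
        ((continuous_const.mul (continuous_circlePoint_zpow _)).mul continuous_const),
        coeff_mul_zpow _ _ (fun _ => 1), coeff_mul_zpow _ _ (fun _ => 1), coeff_one, coeff_one,
        if_neg (show ¬ ((n : ℤ) - -(l + 1 : ℤ) = 0) by omega)]
      by_cases hl : l = n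
      · subst hl; simp
      · rw [if_neg (by omega), if_neg hl]; simp
    simp_rw [hval] at key
    rw [key.unique (hasSum_ite_eq n (a n)), ha, cauchyTransform]
    simp only [hh, mul_div_assoc]
  · rw [mul_one, mul_one]
    refine (norm_add_le _ _).trans (add_le_add ?_ ?_)
    · rw [norm_mul, norm_zpow_of_norm_eq_one hz, mul_one]; exact hab l
    · rw [norm_mul, norm_zpow_of_norm_eq_one hz, mul_one]
  · have hz1 : ‖q * z‖ < 1 := norm_mul_lt_one h0 h1 hz.le
    have hzq := mem_slitDomain_of_norm_le_one h0 h1 hz.le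
    have h2 := (hasSum_cauchyTransform hhc hz1).add (hrs z hz hzc)
    have hz0 : z ≠ 0 := norm_pos_iff.1 (by linarith)
    have hsub : z - c ≠ 0 := sub_ne_zero.2 hzc
    refine hasSum_of_eq h2 (fun l => ?_) ?_
    · simp only [ha, zpow_natCast, mul_one]
      rw [zpow_neg, ← inv_zpow, mul_comm (z ^ l)]
      norm_cast
    · have h3 : cauchyTransform q h z = (z * plusPart q z - c * plusPart q c) / (z - c) := by
        rw [eq_div_iff hsub, plusPart, plusPart, cauchyTransform, cauchyTransform,
          cauchyTransform, ← integral_mul_const, ← integral_const_mul, ← integral_const_mul,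
          ← integral_sub ((integrable_arcsine (continuousOn_div_one_sub hcont hzq)).const_mul _)
            ((integrable_arcsine (continuousOn_div_one_sub hcont hc)).const_mul _)]
        refine integral_arcsine_congr fun x hx => ?_
        have e1 := one_sub_ne_zero hzq hx
        have e2 := one_sub_ne_zero hc hx
        simp only [hh]
        generalize root q (q * x) = y
        generalize (q * x : ℂ) = s at e1 e2 ⊢
        rw [div_div, div_mul_eq_mul_div, mul_div_assoc', mul_div_assoc', div_sub_div _ _ e1 e2,
          div_eq_div_iff (mul_ne_zero e2 e1) (mul_ne_zero e1 e2)]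
        ring
      rw [h3, psi]
      field_simp
      ring

end Psi

/-! ### Generating functions and the coupled integral equations -/

/-- The power series with coefficients `y`. -/
def genFun (y : ℕ → ℂ) (s : ℂ) : ℂ := ∑' j, y j * s ^ j

section GenFun

variable {y : ℕ → ℂ} {K : ℝ} (hy : ∀ j, ‖y j‖ ≤ K)
include hy

lemma norm_genFun_term_le {s : ℂ} {ρ : ℝ} (hs : ‖s‖ ≤ ρ) (j : ℕ) : ‖y j * s ^ j‖ ≤ K * ρ ^ j := by
  rw [norm_mul, norm_pow]
  exact mul_le_mul (hy j) (pow_le_pow_left₀ (norm_nonneg _) hs j) (by positivity)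
    ((norm_nonneg _).trans (hy j))

lemma summable_norm_genFun {s : ℂ} (hs : ‖s‖ < 1) : Summable fun j => ‖y j * s ^ j‖ :=
  Summable.of_nonneg_of_le (fun _ => norm_nonneg _) (norm_genFun_term_le hy le_rfl)
    ((summable_geometric_of_lt_one (norm_nonneg _) hs).mul_left K)

lemma hasSum_genFun {s : ℂ} (hs : ‖s‖ < 1) : HasSum (fun j => y j * s ^ j) (genFun y s) :=
  (summable_norm_genFun hy hs).of_norm.hasSum

lemma continuousOn_genFun {q : ℝ} (h0 : 0 < q) (h1 : q < 1) :
    ContinuousOn (fun x : ℝ => genFun y (q * x)) (Icc 0 1) :=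
  continuousOn_tsum (fun i => by fun_prop) ((summable_geometric_of_lt_one h0.le h1).mul_left K)
    fun i _ hx => norm_genFun_term_le hy (norm_mul_ofReal_le h0 hx) i

lemma hasSum_integral_genFun {q : ℝ} (h0 : 0 < q) (h1 : q < 1) {g : ℝ → ℂ}
    (hg : ContinuousOn g (Icc 0 1)) (n : ℕ) :
    HasSum (fun j => y j * ∫ x : ℝ, (q * x : ℂ) ^ (n + j) * g x ∂arcsine)
      (∫ x : ℝ, (q * x : ℂ) ^ n * (g x * genFun y (q * x)) ∂arcsine) := by
  obtain ⟨M, hM⟩ := isCompact_Icc.exists_bound_of_continuousOn hg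
  simp_rw [← integral_const_mul]
  refine hasSum_integral_arcsine (b := fun j => K * q ^ j * M)
    (fun j => continuousOn_const.mul (ContinuousOn.mul (by fun_prop) hg))
    (((summable_geometric_of_lt_one h0.le h1).mul_left K).mul_right M) (fun j x hx => ?_)
    fun x hx => ?_
  · have hs := norm_mul_ofReal_le h0 hx
    have h2 := norm_genFun_term_le hy hs j
    have h3 : ‖(q * x : ℂ) ^ n‖ ≤ 1 := by
      rw [norm_pow]; exact pow_le_one₀ (norm_nonneg _) (hs.trans h1.le)
    have e : y j * ((q * x : ℂ) ^ (n + j) * g x) =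
        (q * x : ℂ) ^ n * (y j * (q * x : ℂ) ^ j * g x) := by ring
    rw [e, norm_mul]
    refine (mul_le_of_le_one_left (norm_nonneg _) h3).trans ?_
    rw [norm_mul]
    exact mul_le_mul h2 (hM x hx) (norm_nonneg _) ((norm_nonneg _).trans h2)
  · have hs := (norm_mul_ofReal_le h0 hx).trans_lt h1
    refine hasSum_of_eq ((hasSum_genFun hy hs).mul_left ((q * x : ℂ) ^ n * g x)) (fun j => ?_) ?_
    · ring
    · ring

lemma hasSum_mul_genFun {a : ℕ → ℂ} {s P : ℂ} (hs : ‖s‖ < 1)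
    (ha : Summable fun l => ‖a l * s ^ l‖) (hP : HasSum (fun l => a l * s ^ l) P) :
    HasSum (fun m => (∑ l ∈ Finset.range (m + 1), a l * y (m - l)) * s ^ m) (P * genFun y s) := by
  have h2 := hasSum_sum_range_mul_of_summable_norm ha (summable_norm_genFun hy hs)
  rw [hP.tsum_eq] at h2
  refine hasSum_of_eq h2 (fun m => ?_) rfl
  rw [Finset.sum_mul]
  refine Finset.sum_congr rfl fun l hl => ?_
  have : s ^ m = s ^ l * s ^ (m - l) := by
    rw [← pow_add, Nat.add_sub_cancel' (Nat.lt_succ_iff.1 (Finset.mem_range.1 hl))]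
  rw [this]; ring

end GenFun

/-- A vanishing sum whose middle block of N - 1 terms is zero equates its tail with minus its head.
The block comes from the zero entries of e₀ at positions 1, …, N-1. -/
lemma hasSum_tail_of_gap {f : ℕ → ℂ} {m N : ℕ} (hN : 1 ≤ N) (hf : HasSum f 0)
    (hgap : ∀ l, m < l → l < m + N → f l = 0) :
    HasSum (fun j => f (m + N + j)) (-∑ l ∈ Finset.range (m + 1), f l) := by
  have h := (hasSum_nat_add_iff' (m + N)).2 hf
  have e : ∑ i ∈ Finset.range (m + N), f i = ∑ l ∈ Finset.range (m + 1), f l := by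
    symm
    refine Finset.sum_subset (Finset.range_mono (by omega)) fun l hl hl' => hgap l ?_ ?_
    · simpa using hl'
    · simpa using hl
  rw [e, zero_sub] at h
  refine hasSum_of_eq h (fun j => by rw [add_comm]) rfl

/-- The Fourier coefficients of `X φ`, where `X(z) = ∑ x_i z^{-i}`. -/
def rowConv (q : ℝ) {N : ℕ} (x : Fin N → ℂ) (n : ℤ) : ℂ :=
  ∑ i, x i * coeff (isingSymbol q⁻¹) (n + (i : ℤ))

/-- Coefficients of the analytic part of `X φ`. -/
def upperSeq (q : ℝ) {N : ℕ} (x : Fin N → ℂ) (m : ℕ) : ℂ := rowConv q x m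

/-- Coefficients of the part of `X φ` of degree at most `-N`. -/
def lowerSeq (q : ℝ) {N : ℕ} (x : Fin N → ℂ) (j : ℕ) : ℂ := rowConv q x (-N - j)

section System

variable {q : ℝ} (h0 : 0 < q) (h1 : q < 1) {N : ℕ} (x : Fin N → ℂ)
include h0 h1

lemma norm_rowConv_le (n : ℤ) : ‖rowConv q x n‖ ≤ ∑ i, ‖x i‖ := by
  refine (norm_sum_le _ _).trans (Finset.sum_le_sum fun i _ => ?_)
  rw [norm_mul]
  exact mul_le_of_le_one_right (norm_nonneg _) (norm_coeff_isingSymbol_le h0 h1 _)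

lemma hasSum_rootTaylor_mul_rowConv (n : ℤ) :
    HasSum (fun l : ℕ => rootTaylor q l * rowConv q x (n - l))
      (∑ i, x i * coeff (fun z => root q z⁻¹) (n + (i : ℤ))) := by
  have := hasSum_sum (s := Finset.univ) fun (i : Fin N) _ =>
    (hasSum_sqrtCoeff_mul_coeff_isingSymbol h0 h1 (n + (i : ℤ))).mul_left (x i)
  refine hasSum_of_eq this (fun l => ?_) rfl
  rw [rowConv, Finset.mul_sum]
  refine Finset.sum_congr rfl fun i _ => ?_
  rw [rootTaylor, show n - l + (i : ℤ) = n + i - l by ring]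
  ring

lemma hasSum_rootTaylor_mul_rowConv_pos {n : ℤ} (hn : 0 < n) :
    HasSum (fun l : ℕ => rootTaylor q l * rowConv q x (n - l)) 0 := by
  refine hasSum_of_eq (hasSum_rootTaylor_mul_rowConv h0 h1 x n) (fun _ => rfl) ?_
  exact (Finset.sum_eq_zero fun i _ => by
    rw [coeff_root_inv_pos h0 h1 (by omega), mul_zero]).symm

lemma hasSum_moment_mul_rowConv {n : ℤ} (hn : n ≤ -N) :
    HasSum (fun l : ℕ => (moment l : ℂ) * q ^ l * rowConv q x (n + l)) 0 := by
  have := hasSum_sum (s := Finset.univ) fun (i : Fin N) _ =>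
    (hasSum_moment_mul_coeff_isingSymbol h0 h1 (n + (i : ℤ))).mul_left (x i)
  refine hasSum_of_eq this (fun l => ?_) ?_
  · rw [rowConv, Finset.mul_sum]
    refine Finset.sum_congr rfl fun i _ => ?_
    rw [show n + l + (i : ℤ) = n + i + l by ring]
    ring
  · exact (Finset.sum_eq_zero fun i _ => by
      rw [coeff_inv_root_neg h0 h1 (by have := i.2; omega), mul_zero]).symm

/-- A row vector that annihilates every Fourier coefficient of `φ` vanishes. -/
lemma eq_zero_of_rowConv_eq_zero (h : ∀ n, rowConv q x n = 0) : x = 0 := by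
  have key : ∀ m (hm : m < N), x ⟨m, hm⟩ = 0 := by
    intro m
    induction m using Nat.strong_induction_on with
    | _ m ih =>
      intro hm
      have h2 := hasSum_rootTaylor_mul_rowConv h0 h1 x (-m)
      simp only [h, mul_zero] at h2
      have h3 := h2.unique hasSum_zero
      rw [Finset.sum_eq_single ⟨m, hm⟩] at h3
      · have h4 := coeff_root_inv_neg_nat h0 h1 0
        simp only [Nat.cast_zero, neg_zero, pow_zero, mul_one, sqrtCoeff_zero,
          Complex.ofReal_one] at h4
        simpa [h4] using h3
      · intro i _ hi
        rcases lt_trichotomy (i : ℕ) m with him | him | him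
        · rw [ih i him i.2, zero_mul]
        · exact absurd (Fin.ext him) hi
        · rw [coeff_root_inv_pos h0 h1 (by omega), mul_zero]
      · simp
  funext i
  exact key i i.2

lemma continuousOn_upper :
    ContinuousOn (fun t : ℝ => genFun (upperSeq q x) (q * t)) (Icc 0 1) :=
  continuousOn_genFun (fun m => norm_rowConv_le h0 h1 x m) h0 h1

lemma continuousOn_lower :
    ContinuousOn (fun t : ℝ => genFun (lowerSeq q x) (q * t)) (Icc 0 1) :=
  continuousOn_genFun (fun _ => norm_rowConv_le h0 h1 x _) h0 h1

variable (hN : 1 ≤ N) {δ : ℂ} (hx : ∀ j < N, rowConv q x (-(j : ℤ)) = if j = 0 then δ else 0)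
include hN hx

/-- At degree -N-j the head of the vanishing convolution sees only L and the tail, from index j+N
on, only U. The tail coefficients α_l q^l are moments, so the tail is an integral of U. -/
lemma sum_moment_mul_lowerSeq (j : ℕ) :
    ∑ l ∈ Finset.range (j + 1), (moment l : ℂ) * q ^ l * lowerSeq q x (j - l) =
      -∫ t : ℝ, (q * t : ℂ) ^ j * ((q * t) ^ N * genFun (upperSeq q x) (q * t)) ∂arcsine := by
  have h2 := hasSum_tail_of_gap hN (hasSum_moment_mul_rowConv h0 h1 x (n := -N - j) (by omega))
    (m := j) fun l hl hl' => by
      obtain ⟨i, hi⟩ : ∃ i : ℕ, (-N - j + l : ℤ) = -(i : ℤ) := ⟨N + j - l, by omega⟩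
      rw [hi, hx i (by omega), if_neg (by omega), mul_zero]
  have h3 := hasSum_integral_genFun (fun m => norm_rowConv_le h0 h1 x m) h0 h1
    (g := fun _ => 1) continuousOn_const (j + N) (y := upperSeq q x)
  have h4 := h2.unique (hasSum_of_eq h3 (fun m => ?_) rfl)
  · have e : ∀ l ∈ Finset.range (j + 1), (moment l : ℂ) * q ^ l * lowerSeq q x (j - l) =
        (moment l : ℂ) * q ^ l * rowConv q x (-N - j + l) := by
      intro l hl
      rw [lowerSeq, Nat.cast_sub (Nat.lt_succ_iff.1 (Finset.mem_range.1 hl))]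
      congr 2; ring
    rw [Finset.sum_congr rfl e, ← neg_eq_iff_eq_neg, h4]
    congr 1; ext t; ring
  · simp_rw [mul_one, mul_pow]
    rw [integral_const_mul, integral_pow_arcsine_complex, upperSeq]
    rw [show (-N - j + (j + N + m : ℕ) : ℤ) = m by push_cast; ring]
    ring

omit h0 h1 in
lemma sum_rootTaylor_mul_upperSeq_zero :
    ∑ l ∈ Finset.range (0 + 1), rootTaylor q l * upperSeq q x (0 - l) = δ := by
  have := hx 0 (by omega)
  simpa [rootTaylor, sqrtCoeff_zero, upperSeq] using this

/-- At degree m+1 the head sees only U and the tail, from index m+1+N on, only L. The tail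
coefficients are -q∫(qt)^{l-1}(1-t)dμ, the origin of the factors q and 1-t. -/
lemma sum_rootTaylor_mul_upperSeq (m : ℕ) :
    ∑ l ∈ Finset.range (m + 1 + 1), rootTaylor q l * upperSeq q x (m + 1 - l) =
      q * ∫ t : ℝ, (q * t : ℂ) ^ m *
        ((q * t) ^ N * (1 - t) * genFun (lowerSeq q x) (q * t)) ∂arcsine := by
  have h2 := hasSum_tail_of_gap hN (hasSum_rootTaylor_mul_rowConv_pos h0 h1 x
    (n := (m + 1 : ℕ)) (by omega)) (m := m + 1) fun l hl hl' => by
      obtain ⟨i, hi⟩ : ∃ i : ℕ, ((m + 1 : ℕ) - l : ℤ) = -(i : ℤ) := ⟨l - (m + 1), by omega⟩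
      rw [hi, hx i (by omega), if_neg (by omega), mul_zero]
  have h3 := (hasSum_integral_genFun (fun m => norm_rowConv_le h0 h1 x _) h0 h1
    (g := fun t => 1 - (t : ℂ)) (by fun_prop) (m + N) (y := lowerSeq q x)).mul_left (-(q : ℂ))
  have h4 := h2.unique (hasSum_of_eq h3 (fun j => ?_) rfl)
  · have e : ∀ l ∈ Finset.range (m + 1 + 1), rootTaylor q l * upperSeq q x (m + 1 - l) =
        rootTaylor q l * rowConv q x ((m + 1 : ℕ) - l) := by
      intro l hl
      rw [upperSeq, Nat.cast_sub (Nat.lt_succ_iff.1 (Finset.mem_range.1 hl))]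
    rw [Finset.sum_congr rfl e, ← neg_inj, h4, neg_mul]
    congr 3; ext t; ring
  · simp_rw [mul_pow, mul_assoc]
    rw [integral_const_mul, integral_pow_mul_one_sub_complex, lowerSeq, rootTaylor,
      show m + 1 + N + j = m + N + j + 1 by ring,
      show ((m + 1 : ℕ) - (m + N + j + 1 : ℕ) : ℤ) = -N - j by push_cast; ring]
    ring

lemma upper_equation {c : ℂ} (hc : ‖c‖ < 1) :
    root q c * genFun (upperSeq q x) c = δ + q * c * cauchyTransform q
      (fun t => (q * t) ^ N * (1 - t) * genFun (lowerSeq q x) (q * t)) c := by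
  have hcq : ‖q * c‖ < 1 := norm_mul_lt_one h0 h1 hc.le
  have ha : Summable fun l => ‖rootTaylor q l * c ^ l‖ := by
    refine summable_norm_genFun (K := 1) (fun l => (norm_rootTaylor_le h0 l).trans ?_) hc
    rw [one_mul]; exact pow_le_one₀ h0.le h1.le
  have h2 := hasSum_mul_genFun (fun m => norm_rowConv_le h0 h1 x m) (y := upperSeq q x) hc ha
    (hasSum_root' h0 h1 hc.le)
  have h3 := (hasSum_nat_add_iff' 1).2 h2
  have h4 := (hasSum_cauchyTransform (q := q) (c := c)
    (h := fun t => (q * t : ℂ) ^ N * (1 - t) * genFun (lowerSeq q x) (q * t))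
    (ContinuousOn.mul (by fun_prop) (continuousOn_lower h0 h1 x)) hcq).mul_left (q * c)
  have h5 := h3.unique (hasSum_of_eq h4 (fun m => ?_) rfl)
  · rw [Finset.sum_range_one, sum_rootTaylor_mul_upperSeq_zero x hN hx, pow_zero, mul_one]
      at h5
    linear_combination h5
  · rw [sum_rootTaylor_mul_upperSeq h0 h1 x hN hx]
    ring

lemma lower_equation {s : ℂ} (hs : ‖s‖ < 1) :
    (root q s)⁻¹ * genFun (lowerSeq q x) s =
      -cauchyTransform q (fun t => (q * t) ^ N * genFun (upperSeq q x) (q * t)) s := by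
  have hsq : ‖q * s‖ < 1 := norm_mul_lt_one h0 h1 hs.le
  have ha : Summable fun l => ‖(moment l : ℂ) * q ^ l * s ^ l‖ := by
    refine Summable.of_nonneg_of_le (fun _ => norm_nonneg _) (fun l => ?_)
      (summable_norm_moment h0 h1)
    rw [norm_mul _ (s ^ l), norm_pow s]
    exact mul_le_of_le_one_right (norm_nonneg _) (pow_le_one₀ (norm_nonneg _) hs.le)
  have h2 := hasSum_mul_genFun (fun m => norm_rowConv_le h0 h1 x _) (y := lowerSeq q x) hs ha
    (hasSum_inv_root' h0 h1 hs.le)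
  have h4 := (hasSum_cauchyTransform (q := q) (c := s)
    (h := fun t => (q * t : ℂ) ^ N * genFun (upperSeq q x) (q * t))
    (ContinuousOn.mul (by fun_prop) (continuousOn_upper h0 h1 x)) hsq).neg
  refine h2.unique (hasSum_of_eq h4 (fun m => ?_) rfl)
  rw [sum_moment_mul_lowerSeq h0 h1 x hN hx]
  ring

end System

/-! ### Contraction estimates, injectivity and the exact formula -/

section Bounds

variable {q : ℝ} (h0 : 0 < q) (h1 : q < 1)

lemma norm_one_sub_ge (q : ℝ) {s t : ℝ} (hs : s ∈ Icc (0 : ℝ) 1) (ht : t ∈ Icc (0 : ℝ) 1) :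
    1 - q ^ 2 ≤ ‖1 - (q * s : ℂ) * (q * t)‖ := by
  have e : (1 - (q * s : ℂ) * (q * t)) = ((1 - q ^ 2 * (s * t) : ℝ) : ℂ) := by push_cast; ring
  rw [e, Complex.norm_real]
  refine le_trans ?_ (le_abs_self _)
  have : s * t ≤ 1 := mul_le_one₀ hs.2 ht.1 ht.2
  nlinarith [sq_nonneg q]

include h0 h1

lemma one_sub_sq_pos : 0 < 1 - q ^ 2 := by nlinarith

omit h0 h1 in
lemma one_sub_sq_le {t : ℝ} (ht : t ∈ Icc (0 : ℝ) 1) : 1 - q ^ 2 ≤ 1 - q ^ 2 * t := by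
  nlinarith [sq_nonneg q, ht.2]

lemma root_mul_ofReal {t : ℝ} (ht : t ∈ Icc (0 : ℝ) 1) :
    root q (q * t) = (Real.sqrt (1 - q ^ 2 * t) : ℂ) := by
  have h2 : 0 ≤ 1 - q ^ 2 * t := (one_sub_sq_pos h0 h1).le.trans (one_sub_sq_le ht)
  rw [Real.sqrt_eq_rpow, Complex.ofReal_cpow h2, root]
  congr 1
  · push_cast; ring
  · norm_num

lemma norm_root_mul_ofReal_le {t : ℝ} (ht : t ∈ Icc (0 : ℝ) 1) : ‖root q (q * t)‖ ≤ 1 := by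
  rw [root_mul_ofReal h0 h1 ht, Complex.norm_real, Real.norm_eq_abs,
    abs_of_nonneg (Real.sqrt_nonneg _), Real.sqrt_le_iff]
  refine ⟨zero_le_one, ?_⟩
  nlinarith [mul_nonneg (sq_nonneg q) ht.1]

/-- A square root of a number in [0,1] exceeds the number. The crude bound lets every later constant
be a power of (1 - q²)⁻¹. -/
lemma one_sub_sq_le_norm_root {t : ℝ} (ht : t ∈ Icc (0 : ℝ) 1) :
    1 - q ^ 2 ≤ ‖root q (q * t)‖ := by
  rw [root_mul_ofReal h0 h1 ht, Complex.norm_real, Real.norm_eq_abs,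
    abs_of_nonneg (Real.sqrt_nonneg _)]
  have h2 := one_sub_sq_pos h0 h1
  have h3 := one_sub_sq_le (q := q) ht
  refine h3.trans (Real.le_sqrt_of_sq_le ?_)
  nlinarith [sq_nonneg q, ht.1, mul_nonneg (sq_nonneg q) ht.1]

lemma norm_inv_root_mul_ofReal_le {t : ℝ} (ht : t ∈ Icc (0 : ℝ) 1) :
    ‖(root q (q * t))⁻¹‖ ≤ (1 - q ^ 2)⁻¹ := by
  rw [norm_inv]
  exact inv_anti₀ (one_sub_sq_pos h0 h1) (one_sub_sq_le_norm_root h0 h1 ht)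

lemma mul_mem_slitDomain_ofReal {s : ℝ} (hs : s ∈ Icc (0 : ℝ) 1) : (q * s : ℂ) ∈ slitDomain q :=
  mem_slitDomain_of_norm_le_one h0 h1 ((norm_mul_ofReal_le h0 hs).trans h1.le)

lemma norm_cauchyTransform_le {s : ℝ} (hs : s ∈ Icc (0 : ℝ) 1) {h : ℝ → ℂ} {b : ℝ → ℝ}
    (hb : ContinuousOn b (Icc 0 1)) (hhb : ∀ t ∈ Icc (0 : ℝ) 1, ‖h t‖ ≤ b t) :
    ‖cauchyTransform q h (q * s)‖ ≤ (1 - q ^ 2)⁻¹ * ∫ t, b t ∂arcsine := by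
  rw [← integral_const_mul]
  refine norm_integral_arcsine_le (continuousOn_const.mul hb) fun t ht => ?_
  rw [norm_div, div_eq_inv_mul]
  have h2 := one_sub_sq_pos h0 h1
  have h3 := norm_one_sub_ge q hs ht
  exact mul_le_mul (inv_anti₀ h2 h3) (hhb t ht) (norm_nonneg _) (by positivity)

omit h1 in
lemma norm_mul_pow {t : ℝ} (ht : t ∈ Icc (0 : ℝ) 1) (N : ℕ) :
    ‖(q * t : ℂ) ^ N‖ = q ^ N * t ^ N := by
  rw [norm_pow, norm_mul, Complex.norm_real, Complex.norm_real, Real.norm_eq_abs, Real.norm_eq_abs,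
    abs_of_nonneg ht.1, abs_of_pos h0, mul_pow]

variable {N : ℕ} (x : Fin N → ℂ) (hN : 1 ≤ N) {δ : ℂ}
  (hx : ∀ j < N, rowConv q x (-(j : ℤ)) = if j = 0 then δ else 0)
include hN hx

lemma norm_lower_le {a : ℝ} (ha : ∀ t ∈ Icc (0 : ℝ) 1, ‖genFun (upperSeq q x) (q * t)‖ ≤ a)
    {s : ℝ} (hs : s ∈ Icc (0 : ℝ) 1) :
    ‖genFun (lowerSeq q x) (q * s)‖ ≤ (1 - q ^ 2)⁻¹ * (q ^ N * moment N * a) := by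
  have hs1 : ‖(q * s : ℂ)‖ < 1 := (norm_mul_ofReal_le h0 hs).trans_lt h1
  have h2 := lower_equation h0 h1 x hN hx hs1
  have hr := root_ne_zero_of_norm_le h0 h1 hs1.le
  have h3 : genFun (lowerSeq q x) (q * s) = root q (q * s) *
      -cauchyTransform q (fun t => (q * t) ^ N * genFun (upperSeq q x) (q * t)) (q * s) := by
    rw [← h2, mul_inv_cancel_left₀ hr]
  rw [h3, norm_mul, norm_neg]
  refine (mul_le_of_le_one_left (norm_nonneg _) (norm_root_mul_ofReal_le h0 h1 hs)).trans ?_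
  refine (norm_cauchyTransform_le h0 h1 hs (b := fun t => q ^ N * t ^ N * a) (by fun_prop)
    fun t ht => ?_).trans (le_of_eq ?_)
  · rw [norm_mul, norm_mul_pow h0 ht]
    exact mul_le_mul_of_nonneg_left (ha t ht) (mul_nonneg (by positivity) (pow_nonneg ht.1 _))
  · rw [integral_mul_const, integral_const_mul, integral_pow_arcsine]

lemma norm_upper_sub_le {b : ℝ} (hb : ∀ t ∈ Icc (0 : ℝ) 1, ‖genFun (lowerSeq q x) (q * t)‖ ≤ b)
    {s : ℝ} (hs : s ∈ Icc (0 : ℝ) 1) :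
    ‖genFun (upperSeq q x) (q * s) - δ * (root q (q * s))⁻¹‖ ≤
      (1 - q ^ 2)⁻¹ * ((1 - q ^ 2)⁻¹ * (q ^ N * b)) := by
  have hs1 : ‖(q * s : ℂ)‖ < 1 := (norm_mul_ofReal_le h0 hs).trans_lt h1
  have h2 := upper_equation h0 h1 x hN hx hs1
  have hr := root_ne_zero_of_norm_le h0 h1 hs1.le
  have h3 : genFun (upperSeq q x) (q * s) - δ * (root q (q * s))⁻¹ = (root q (q * s))⁻¹ *
      (q * (q * s) * cauchyTransform q
        (fun t => (q * t) ^ N * (1 - t) * genFun (lowerSeq q x) (q * t)) (q * s)) := by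
    field_simp
    linear_combination h2
  have hpos := one_sub_sq_pos h0 h1
  rw [h3, norm_mul]
  refine mul_le_mul (norm_inv_root_mul_ofReal_le h0 h1 hs) ?_ (norm_nonneg _) (by positivity)
  rw [norm_mul]
  have h4 : ‖(q * (q * s) : ℂ)‖ ≤ 1 := by
    rw [norm_mul, Complex.norm_real, Real.norm_eq_abs, abs_of_pos h0]
    exact mul_le_one₀ h1.le (norm_nonneg _) hs1.le
  refine (mul_le_of_le_one_left (norm_nonneg _) h4).trans ?_
  refine (norm_cauchyTransform_le h0 h1 hs (b := fun _ => q ^ N * b) (by fun_prop)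
    fun t ht => ?_).trans (le_of_eq (by simp))
  have h5 : ‖(1 - t : ℂ)‖ ≤ 1 := by
    rw [← Complex.ofReal_one, ← Complex.ofReal_sub, Complex.norm_real, Real.norm_eq_abs, abs_le]
    constructor <;> linarith [ht.1, ht.2]
  rw [norm_mul, norm_mul, norm_mul_pow h0 ht]
  have h6 : q ^ N * t ^ N * ‖(1 - t : ℂ)‖ ≤ q ^ N := by
    have := pow_le_one₀ (n := N) ht.1 ht.2
    have h7 : t ^ N * ‖(1 - t : ℂ)‖ ≤ 1 := mul_le_one₀ this (norm_nonneg _) h5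
    rw [mul_assoc]
    exact mul_le_of_le_one_right (by positivity) h7
  exact mul_le_mul h6 (hb t ht) (norm_nonneg _) (by positivity)

/-- At a maximum point of |U(qs)| on [0,1], feeding the bound for L into the equation for U gives a
≤ (1 - q²)⁻¹|δ| + a/2, and the last term is absorbed. -/
lemma norm_upper_le (hsmall : (1 - q ^ 2)⁻¹ ^ 3 * (q ^ N * q ^ N) ≤ 1 / 2) {s : ℝ}
    (hs : s ∈ Icc (0 : ℝ) 1) :
    ‖genFun (upperSeq q x) (q * s)‖ ≤ 2 * ((1 - q ^ 2)⁻¹ * ‖δ‖) := by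
  obtain ⟨s₀, hs₀, hmax⟩ := isCompact_Icc.exists_isMaxOn (nonempty_Icc.2 zero_le_one)
    (continuousOn_upper h0 h1 x).norm
  set a := ‖genFun (upperSeq q x) (q * s₀)‖ with ha
  have hpos := one_sub_sq_pos h0 h1
  have h2 := norm_upper_sub_le h0 h1 x hN hx
    (fun t ht => norm_lower_le h0 h1 x hN hx (fun t ht => hmax ht) ht) hs₀
  have h3 : ‖δ * (root q (q * s₀))⁻¹‖ ≤ (1 - q ^ 2)⁻¹ * ‖δ‖ := by
    rw [norm_mul, mul_comm]
    exact mul_le_mul_of_nonneg_right (norm_inv_root_mul_ofReal_le h0 h1 hs₀) (norm_nonneg _)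
  have h4 : (1 - q ^ 2)⁻¹ * ((1 - q ^ 2)⁻¹ * (q ^ N * ((1 - q ^ 2)⁻¹ * (q ^ N * moment N * a)))) ≤
      1 / 2 * a := by
    calc _ = ((1 - q ^ 2)⁻¹ ^ 3 * (q ^ N * q ^ N)) * (moment N * a) := by ring
      _ ≤ 1 / 2 * (1 * a) := by
        refine mul_le_mul hsmall ?_ (mul_nonneg (moment_pos N).le (norm_nonneg _)) (by norm_num)
        exact mul_le_mul_of_nonneg_right (moment_le_one N) (norm_nonneg _)
      _ = _ := by ring
  have h5 : a ≤ ‖genFun (upperSeq q x) (q * s₀) - δ * (root q (q * s₀))⁻¹‖ +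
      ‖δ * (root q (q * s₀))⁻¹‖ := by
    simpa using norm_add_le (genFun (upperSeq q x) (q * s₀) - δ * (root q (q * s₀))⁻¹)
      (δ * (root q (q * s₀))⁻¹)
  have h6 : ‖genFun (upperSeq q x) (q * s)‖ ≤ a := hmax hs
  linarith

omit hx in
/-- Injectivity of the finite Toeplitz matrix of the Ising symbol. -/
lemma eq_zero_of_system (hsmall : (1 - q ^ 2)⁻¹ ^ 3 * (q ^ N * q ^ N) ≤ 1 / 2)
    (hx0 : ∀ j < N, rowConv q x (-(j : ℤ)) = 0) : x = 0 := by
  have hx : ∀ j < N, rowConv q x (-(j : ℤ)) = if j = 0 then (0 : ℂ) else 0 := fun j hj => by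
    simp [hx0 j hj]
  -- The a priori bound with δ = 0. The right-hand sides of the triangular recursions then vanish,
  -- first for L and then for U; their leading coefficients are 1, so all coefficients are zero.
  have hA : ∀ t ∈ Icc (0 : ℝ) 1, genFun (upperSeq q x) (q * t) = 0 := fun t ht => by
    simpa using norm_upper_le h0 h1 x hN hx hsmall ht
  have hlow : ∀ j, lowerSeq q x j = 0 := by
    intro j
    induction j using Nat.strong_induction_on with
    | _ j ih =>
      have h2 := sum_moment_mul_lowerSeq h0 h1 x hN hx j
      rw [integral_arcsine_congr (h' := fun _ => 0) fun t ht => by rw [hA t ht]; ring,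
        integral_zero, neg_zero, Finset.sum_range_succ'] at h2
      rw [Finset.sum_eq_zero fun l hl => by
        rw [ih _ (by have := Finset.mem_range.1 hl; omega), mul_zero]] at h2
      simpa [moment_zero] using h2
  have hB : ∀ t : ℝ, genFun (lowerSeq q x) (q * t) = 0 := fun t => by simp [genFun, hlow]
  have hup : ∀ m, upperSeq q x m = 0 := by
    intro m
    induction m using Nat.strong_induction_on with
    | _ m ih =>
      cases m with
      | zero => simpa [upperSeq] using hx0 0 (by omega)
      | succ m =>
        have h2 := sum_rootTaylor_mul_upperSeq h0 h1 x hN hx m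
        simp only [hB, mul_zero, integral_zero] at h2
        rw [Finset.sum_range_succ', Finset.sum_eq_zero fun l hl => by
          rw [ih _ (by have := Finset.mem_range.1 hl; omega), mul_zero]] at h2
        simpa [rootTaylor, sqrtCoeff_zero] using h2
  refine eq_zero_of_rowConv_eq_zero h0 h1 x fun n => ?_
  rcases le_or_gt 0 n with hn | hn
  · obtain ⟨m, rfl⟩ := Int.eq_ofNat_of_zero_le hn
    exact hup m
  · by_cases h2 : -N < n
    · obtain ⟨j, hj⟩ : ∃ j : ℕ, n = -(j : ℤ) := ⟨n.natAbs, by omega⟩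
      rw [hj]
      exact hx0 j (by omega)
    · obtain ⟨j, hj⟩ : ∃ j : ℕ, n = -N - (j : ℤ) := ⟨(-N - n).natAbs, by omega⟩
      rw [hj]
      exact hlow j

/-- The exact form of the quantity `F_N` in terms of the lower generating function. -/
lemma sum_cauchyTransform_eq {c : ℂ} (hc : c ∈ slitDomain q) :
    ∑ i : Fin N, x i * cauchyTransform q (fun t => (q * t : ℂ) ^ (i : ℕ) * root q (q * t)) c =
      (root q c)⁻¹ * (δ + q * c * cauchyTransform q
        (fun t => (q * t) ^ N * (1 - t) * genFun (lowerSeq q x) (q * t)) c) := by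
  have hq : |q| ≤ 1 := by rw [abs_of_pos h0]; exact h1.le
  have hcont := continuousOn_root_mul h0 h1
  have hlc : ContinuousOn (fun t : ℝ =>
      (q * t : ℂ) ^ N * (1 - t) * genFun (lowerSeq q x) (q * t)) (Icc 0 1) :=
    ContinuousOn.mul (by fun_prop) (continuousOn_lower h0 h1 x)
  have hic : ∀ i : ℕ, ContinuousOn (fun t : ℝ => (q * t : ℂ) ^ i * root q (q * t)) (Icc 0 1) :=
    fun i => ContinuousOn.mul (by fun_prop) hcont
  -- Near c = 0 both sides equal U(c): the coefficient of c^m on the left is ∑ x_i [φ]_{m+i} = U_m,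
  -- and the right side is the equation for U.
  refine eqOn_slitDomain (F := fun c => ∑ i : Fin N, x i *
      cauchyTransform q (fun t => (q * t : ℂ) ^ (i : ℕ) * root q (q * t)) c)
    (G := fun c => (root q c)⁻¹ * (δ + q * c * cauchyTransform q
        (fun t => (q * t) ^ N * (1 - t) * genFun (lowerSeq q x) (q * t)) c)) ?_ ?_ ?_ hc
  · exact DifferentiableOn.fun_sum fun i _ =>
      (differentiableOn_cauchyTransform hq (hic i)).const_mul _
  · refine DifferentiableOn.mul ((differentiableOn_root q).fun_inv fun z hz =>
      root_ne_zero (Complex.slitPlane_ne_zero hz)) ?_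
    refine DifferentiableOn.const_add _ (DifferentiableOn.mul (by fun_prop) ?_)
    exact differentiableOn_cauchyTransform hq hlc
  · filter_upwards [Metric.ball_mem_nhds (0 : ℂ) one_pos] with z hz
    have hz1 : ‖z‖ < 1 := by simpa using hz
    have hzq := norm_mul_lt_one h0 h1 hz1.le
    rw [← upper_equation h0 h1 x hN hx hz1,
      inv_mul_cancel_left₀ (root_ne_zero_of_norm_le h0 h1 hz1.le)]
    have h2 := hasSum_sum (s := Finset.univ) fun (i : Fin N) _ =>
      (hasSum_cauchyTransform (hic i) hzq).mul_left (x i)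
    refine h2.unique (hasSum_of_eq (hasSum_genFun (fun m => norm_rowConv_le h0 h1 x m) hz1)
      (fun m => ?_) rfl)
    simp only [rowConv, Finset.sum_mul]
    refine Finset.sum_congr rfl fun i _ => ?_
    rw [← Nat.cast_add, coeff_isingSymbol_nat h0 h1]
    simp_rw [pow_add, mul_assoc]
    ring

end Bounds

/-! ### Invertibility of the Toeplitz matrix and the row that computes F_N -/

section Toeplitz

variable {q : ℝ} (h0 : 0 < q) (h1 : q < 1) {N : ℕ} (hN : 1 ≤ N)
include h0 h1 hN

omit h0 h1 hN in
lemma vecMul_toeplitz (x : Fin N → ℂ) (j : Fin N) :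
    Matrix.vecMul x (toeplitz N (isingSymbol q⁻¹)) j = rowConv q x (-(j : ℤ)) := by
  simp only [Matrix.vecMul, dotProduct, toeplitz, Matrix.of_apply, rowConv]
  refine Finset.sum_congr rfl fun i _ => ?_
  rw [neg_add_eq_sub]

lemma isUnit_toeplitz (hsmall : (1 - q ^ 2)⁻¹ ^ 3 * (q ^ N * q ^ N) ≤ 1 / 2) :
    IsUnit (toeplitz N (isingSymbol q⁻¹)) := by
  rw [← Matrix.vecMul_injective_iff_isUnit]
  intro y z hyz
  rw [← sub_eq_zero]
  refine eq_zero_of_system h0 h1 (y - z) hN hsmall fun j hj => ?_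
  have h2 := vecMul_toeplitz (q := q) (y - z) ⟨j, hj⟩
  rw [← h2, Matrix.sub_vecMul]
  simp only at hyz
  rw [hyz, sub_self, Pi.zero_apply]

/-- The first row of the inverse Toeplitz matrix solves the system, and computes `F`. -/
lemma exists_row (hsmall : (1 - q ^ 2)⁻¹ ^ 3 * (q ^ N * q ^ N) ≤ 1 / 2) :
    ∃ x : Fin N → ℂ, (∀ j < N, rowConv q x (-(j : ℤ)) = if j = 0 then 1 else 0) ∧
      ∀ ψ, F N (isingSymbol q⁻¹) ψ = ∑ i : Fin N, x i * coeff ψ ((i : ℕ) : ℤ) := by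
  have hu := isUnit_toeplitz h0 h1 hN hsmall
  rw [Matrix.isUnit_iff_isUnit_det] at hu
  refine ⟨Matrix.vecMul (e0 N) (toeplitz N (isingSymbol q⁻¹))⁻¹, fun j hj => ?_, fun ψ => ?_⟩
  · have h2 := vecMul_toeplitz (q := q) (Matrix.vecMul (e0 N) (toeplitz N (isingSymbol q⁻¹))⁻¹)
      ⟨j, hj⟩
    rw [← h2, Matrix.vecMul_vecMul, Matrix.nonsing_inv_mul _ hu, Matrix.vecMul_one]
    rfl
  · rw [F, ← Matrix.mulVec_mulVec, Matrix.dotProduct_mulVec, dotProduct]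
    refine Finset.sum_congr rfl fun i _ => ?_
    congr 1
    simp only [Matrix.mulVec, dotProduct, e0, toeplitz, Matrix.of_apply]
    rw [Finset.sum_eq_single ⟨0, hN⟩]
    · simp
    · intro b _ hb
      rw [if_neg (fun h => hb (Fin.ext h)), mul_zero]
    · simp

end Toeplitz

/-! ### Freezing the integrands at t = 1 -/

/-- Lipschitz behaviour at the right end point of `[0, 1]`. -/
def LipAtOne (h : ℝ → ℂ) : Prop := ∃ L : ℝ, ∀ t ∈ Icc (0 : ℝ) 1, ‖h t - h 1‖ ≤ L * (1 - t)

lemma LipAtOne.mul {g h : ℝ → ℂ} (hg : LipAtOne g) (hh : LipAtOne h) :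
    LipAtOne fun t => g t * h t := by
  obtain ⟨L, hL⟩ := hg
  obtain ⟨M, hM⟩ := hh
  refine ⟨L * (‖h 1‖ + |M|) + ‖g 1‖ * M, fun t ht => ?_⟩
  have e : g t * h t - g 1 * h 1 = (g t - g 1) * h t + g 1 * (h t - h 1) := by ring
  have ht0 : 0 ≤ 1 - t := by linarith [ht.2]
  have h2 : ‖h t‖ ≤ ‖h 1‖ + |M| := by
    have h3 := norm_add_le (h 1) (h t - h 1)
    rw [add_sub_cancel] at h3
    have h4 : M * (1 - t) ≤ |M| := by
      refine (mul_le_mul_of_nonneg_right (le_abs_self M) ht0).trans ?_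
      exact mul_le_of_le_one_right (abs_nonneg M) (by linarith [ht.1])
    linarith [hM t ht]
  rw [e]
  refine (norm_add_le _ _).trans ?_
  rw [norm_mul, norm_mul]
  calc _ ≤ L * (1 - t) * (‖h 1‖ + |M|) + ‖g 1‖ * (M * (1 - t)) := by
        refine add_le_add ?_ (mul_le_mul_of_nonneg_left (hM t ht) (norm_nonneg _))
        exact mul_le_mul (hL t ht) h2 (norm_nonneg _) ((norm_nonneg _).trans (hL t ht))
    _ = _ := by ring

lemma lipAtOne_const (a : ℂ) : LipAtOne fun _ => a := ⟨0, by simp⟩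

lemma one_mem_Icc : (1 : ℝ) ∈ Icc (0 : ℝ) 1 := ⟨zero_le_one, le_rfl⟩

lemma norm_one_sub_ofReal {t : ℝ} (ht : t ∈ Icc (0 : ℝ) 1) : ‖(1 - t : ℂ)‖ = 1 - t := by
  rw [← Complex.ofReal_one, ← Complex.ofReal_sub, Complex.norm_real, Real.norm_eq_abs,
    abs_of_nonneg (by linarith [ht.2])]

lemma norm_inv_one_sub_sub_le {q δ : ℝ} {c : ℂ} (hδ : 0 < δ)
    (h : ∀ t ∈ Icc (0 : ℝ) 1, δ ≤ ‖1 - c * (q * t)‖) {t : ℝ} (ht : t ∈ Icc (0 : ℝ) 1) :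
    ‖(1 - c * (q * t))⁻¹ - (1 - c * (q * (1 : ℝ)))⁻¹‖ ≤ ‖c * q‖ * δ⁻¹ ^ 2 * (1 - t) := by
  have h1 := h t ht
  have h2 := h 1 one_mem_Icc
  have n1 : 1 - c * (q * t) ≠ 0 := norm_pos_iff.1 (hδ.trans_le h1)
  have n2 : 1 - c * (q * (1 : ℝ)) ≠ 0 := norm_pos_iff.1 (hδ.trans_le h2)
  have e : (1 - c * (q * t))⁻¹ - (1 - c * (q * (1 : ℝ)))⁻¹ =
      c * q * (-(1 - t)) * ((1 - c * (q * t))⁻¹ * (1 - c * (q * (1 : ℝ)))⁻¹) := by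
    rw [inv_sub_inv n1 n2, div_eq_mul_inv, mul_inv]
    push_cast
    ring
  rw [e, norm_mul, norm_mul, norm_mul (1 - c * (q * t))⁻¹, norm_neg, norm_one_sub_ofReal ht,
    norm_inv, norm_inv]
  have h0 : 0 ≤ 1 - t := by linarith [ht.2]
  calc _ ≤ ‖c * q‖ * (1 - t) * (δ⁻¹ * δ⁻¹) := by
        have := mul_nonneg (norm_nonneg (c * q)) h0
        gcongr
    _ = _ := by ring

lemma lipAtOne_inv_one_sub {q : ℝ} {c : ℂ} (hc : c ∈ slitDomain q) :
    LipAtOne fun t => (1 - c * (q * t))⁻¹ := by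
  obtain ⟨δ, hδ, h⟩ := exists_lower_bound hc
  exact ⟨_, fun t ht => norm_inv_one_sub_sub_le hδ h ht⟩

section Approx

variable {q : ℝ} (h0 : 0 < q) (h1 : q < 1)
include h0 h1

lemma norm_root_sub_root_le {t : ℝ} (ht : t ∈ Icc (0 : ℝ) 1) :
    ‖root q (q * t) - root q (q * (1 : ℝ))‖ ≤ (1 - q ^ 2)⁻¹ * (1 - t) := by
  rw [root_mul_ofReal h0 h1 ht, root_mul_ofReal h0 h1 one_mem_Icc, ← Complex.ofReal_sub,
    Complex.norm_real, Real.norm_eq_abs]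
  have hpos := one_sub_sq_pos h0 h1
  have h2 := one_sub_sq_le (q := q) ht
  have hle : Real.sqrt (1 - q ^ 2 * 1) ≤ Real.sqrt (1 - q ^ 2 * t) :=
    Real.sqrt_le_sqrt (by rw [mul_one]; exact h2)
  rw [abs_of_nonneg (sub_nonneg.2 hle), inv_mul_eq_div, le_div_iff₀ hpos]
  set u := Real.sqrt (1 - q ^ 2 * t) with hu
  set v := Real.sqrt (1 - q ^ 2 * 1) with hv
  have hu2 : u * u = 1 - q ^ 2 * t := Real.mul_self_sqrt (hpos.le.trans h2)
  have hv2 : v * v = 1 - q ^ 2 * 1 := Real.mul_self_sqrt (by rw [mul_one]; exact hpos.le)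
  have hv1 : 1 - q ^ 2 ≤ v := Real.le_sqrt_of_sq_le (by nlinarith [sq_nonneg q])
  have hu0 : 0 ≤ u := Real.sqrt_nonneg _
  have ht0 : 0 ≤ 1 - t := by linarith [ht.2]
  have h3 : (u - v) * (1 - q ^ 2) ≤ (u - v) * (u + v) :=
    mul_le_mul_of_nonneg_left (by linarith) (sub_nonneg.2 hle)
  have h4 : (u - v) * (u + v) = q ^ 2 * (1 - t) := by linear_combination hu2 - hv2
  have h5 : q ^ 2 * (1 - t) ≤ 1 - t := mul_le_of_le_one_left ht0 (by nlinarith)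
  linarith

lemma lipAtOne_root : LipAtOne fun t => root q (q * t) :=
  ⟨_, fun _ ht => norm_root_sub_root_le h0 h1 ht⟩

lemma norm_inv_root_sub_le {t : ℝ} (ht : t ∈ Icc (0 : ℝ) 1) :
    ‖(root q (q * t))⁻¹ - (root q (q * (1 : ℝ)))⁻¹‖ ≤ (1 - q ^ 2)⁻¹ ^ 3 * (1 - t) := by
  have hne : ∀ t ∈ Icc (0 : ℝ) 1, root q (q * t) ≠ 0 := fun t ht =>
    root_ne_zero_of_norm_le h0 h1 ((norm_mul_ofReal_le h0 ht).trans h1.le)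
  have e : (root q (q * t))⁻¹ - (root q (q * (1 : ℝ)))⁻¹ =
      -(root q (q * t) - root q (q * (1 : ℝ))) *
        ((root q (q * t))⁻¹ * (root q (q * (1 : ℝ)))⁻¹) := by
    rw [inv_sub_inv (hne t ht) (hne 1 one_mem_Icc), div_eq_mul_inv, mul_inv]
    ring
  have ht0 : 0 ≤ 1 - t := by linarith [ht.2]
  have hpos := inv_pos.2 (one_sub_sq_pos h0 h1)
  rw [e, norm_mul, norm_neg, norm_mul]
  calc _ ≤ (1 - q ^ 2)⁻¹ * (1 - t) * ((1 - q ^ 2)⁻¹ * (1 - q ^ 2)⁻¹) := by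
        refine mul_le_mul (norm_root_sub_root_le h0 h1 ht) ?_ (by positivity) (by positivity)
        exact mul_le_mul (norm_inv_root_mul_ofReal_le h0 h1 ht)
          (norm_inv_root_mul_ofReal_le h0 h1 one_mem_Icc) (norm_nonneg _) hpos.le
    _ = _ := by ring

/-- Relative error in the leading order asymptotics of the lower generating function. -/
def lowerError (q : ℝ) (N : ℕ) : ℝ :=
  2 * (1 - q ^ 2)⁻¹ ^ 5 * (q ^ N * q ^ N) +
    ((1 - q ^ 2)⁻¹ ^ 3 + (1 - q ^ 2)⁻¹ ^ 4) / (2 * N + 2)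

/-- Profile of the leading order asymptotics of the lower generating function. -/
def lowerProfile (q : ℝ) (s : ℝ) : ℂ :=
  root q (q * s) * ((root q (q * (1 : ℝ)))⁻¹ * (1 - q * (q * s) : ℂ)⁻¹)

variable {N : ℕ} (x : Fin N → ℂ) (hN : 1 ≤ N)
  (hx : ∀ j < N, rowConv q x (-(j : ℤ)) = if j = 0 then (1 : ℂ) else 0)
  (hsmall : (1 - q ^ 2)⁻¹ ^ 3 * (q ^ N * q ^ N) ≤ 1 / 2)
include hN hx hsmall

lemma norm_upper_sub_inv_root_le {s : ℝ} (hs : s ∈ Icc (0 : ℝ) 1) :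
    ‖genFun (upperSeq q x) (q * s) - (root q (q * s))⁻¹‖ ≤
      2 * (1 - q ^ 2)⁻¹ ^ 4 * (q ^ N * q ^ N) := by
  have h2 := norm_upper_sub_le h0 h1 x hN hx (fun t ht => norm_lower_le h0 h1 x hN hx
    (fun t ht => norm_upper_le h0 h1 x hN hx hsmall ht) ht) hs
  rw [one_mul] at h2
  refine h2.trans ?_
  have hpos := inv_pos.2 (one_sub_sq_pos h0 h1)
  calc _ = 2 * (1 - q ^ 2)⁻¹ ^ 4 * (q ^ N * q ^ N) * moment N := by rw [norm_one]; ring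
    _ ≤ _ := mul_le_of_le_one_right (by positivity) (moment_le_one N)

/-- Replacing U by 1/r costs O(q^{2N}); freezing 1/r and the Cauchy kernel at t = 1 costs a multiple
of 1 - t, which integration against t^N turns into a relative 1/(2N+2). -/
lemma norm_upper_div_sub_le {s t : ℝ} (hs : s ∈ Icc (0 : ℝ) 1) (ht : t ∈ Icc (0 : ℝ) 1) :
    ‖genFun (upperSeq q x) (q * t) / (1 - q * s * (q * t)) -
      (root q (q * (1 : ℝ)))⁻¹ * (1 - q * (q * s) : ℂ)⁻¹‖ ≤
      2 * (1 - q ^ 2)⁻¹ ^ 5 * (q ^ N * q ^ N) +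
        ((1 - q ^ 2)⁻¹ ^ 3 + (1 - q ^ 2)⁻¹ ^ 4) * (1 - t) := by
  set κ := (1 - q ^ 2)⁻¹ with hκ
  have hm := one_sub_sq_pos h0 h1
  have hpos : 0 < κ := inv_pos.2 hm
  have ht0 : 0 ≤ 1 - t := by linarith [ht.2]
  set A := genFun (upperSeq q x) (q * t)
  set g := (root q (q * t))⁻¹
  set g1 := (root q (q * (1 : ℝ)))⁻¹
  set d := (1 - q * s * (q * t) : ℂ)⁻¹ with hd
  set d1 := (1 - q * s * (q * (1 : ℝ)) : ℂ)⁻¹ with hd1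
  have ed : (1 - q * (q * s) : ℂ)⁻¹ = d1 := by rw [hd1]; push_cast; congr 1; ring
  have hdle : ∀ t ∈ Icc (0 : ℝ) 1, ‖(1 - q * s * (q * t) : ℂ)⁻¹‖ ≤ κ := fun t ht => by
    rw [norm_inv]; exact inv_anti₀ hm (norm_one_sub_ge q hs ht)
  have hdd : ‖d - d1‖ ≤ κ ^ 2 * (1 - t) := by
    refine (norm_inv_one_sub_sub_le hm (fun t ht => norm_one_sub_ge q hs ht) ht).trans ?_
    rw [mul_assoc]
    refine mul_le_of_le_one_left (by positivity) ?_
    rw [norm_mul, Complex.norm_real, Real.norm_eq_abs, abs_of_pos h0]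
    exact mul_le_one₀ ((norm_mul_ofReal_le h0 hs).trans h1.le) h0.le h1.le
  have e : A / (1 - q * s * (q * t)) - g1 * (1 - q * (q * s) : ℂ)⁻¹ =
      (A - g) * d + (g * (d - d1) + (g - g1) * d1) := by rw [ed, div_eq_mul_inv]; ring
  rw [e]
  refine (norm_add_le _ _).trans ?_
  have h2 : ‖(A - g) * d‖ ≤ 2 * κ ^ 4 * (q ^ N * q ^ N) * κ := by
    rw [norm_mul]
    exact mul_le_mul (norm_upper_sub_inv_root_le h0 h1 x hN hx hsmall ht) (hdle t ht)
      (norm_nonneg _) (by positivity)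
  have h3 : ‖g * (d - d1)‖ ≤ κ * (κ ^ 2 * (1 - t)) := by
    rw [norm_mul]
    exact mul_le_mul (norm_inv_root_mul_ofReal_le h0 h1 ht) hdd (norm_nonneg _) hpos.le
  have h4 : ‖(g - g1) * d1‖ ≤ κ ^ 3 * (1 - t) * κ := by
    rw [norm_mul]
    exact mul_le_mul (norm_inv_root_sub_le h0 h1 ht) (hdle 1 one_mem_Icc) (norm_nonneg _)
      (by positivity)
  have h5 := norm_add_le (g * (d - d1)) ((g - g1) * d1)
  calc _ ≤ 2 * κ ^ 4 * (q ^ N * q ^ N) * κ + (κ * (κ ^ 2 * (1 - t)) + κ ^ 3 * (1 - t) * κ) := by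
        linarith
    _ = _ := by ring

lemma norm_lower_add_profile_le {s : ℝ} (hs : s ∈ Icc (0 : ℝ) 1) :
    ‖genFun (lowerSeq q x) (q * s) + q ^ N * moment N * lowerProfile q s‖ ≤
      q ^ N * moment N * lowerError q N := by
  have hs1 : ‖(q * s : ℂ)‖ < 1 := (norm_mul_ofReal_le h0 hs).trans_lt h1
  have h2 := lower_equation h0 h1 x hN hx hs1
  have hr := root_ne_zero_of_norm_le h0 h1 hs1.le
  set G : ℂ := (root q (q * (1 : ℝ)))⁻¹ * (1 - q * (q * s) : ℂ)⁻¹ with hG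
  set h : ℝ → ℂ := fun t => (q * t : ℂ) ^ N * genFun (upperSeq q x) (q * t) with hh
  have hhc : ContinuousOn h (Icc 0 1) := ContinuousOn.mul (by fun_prop) (continuousOn_upper h0 h1 x)
  have hmom : ∫ t : ℝ, (q * t : ℂ) ^ N * G ∂arcsine = q ^ N * moment N * G := by
    simp_rw [mul_pow]
    rw [integral_mul_const, integral_const_mul, integral_pow_arcsine_complex]
  have h3 : genFun (lowerSeq q x) (q * s) + q ^ N * moment N * lowerProfile q s =
      -root q (q * s) * ∫ t : ℝ, (h t / (1 - q * s * (q * t)) - (q * t : ℂ) ^ N * G) ∂arcsine := by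
    rw [integral_sub (integrable_arcsine (continuousOn_div_one_sub hhc
      (mul_mem_slitDomain_ofReal h0 h1 hs))) (integrable_arcsine (by fun_prop)), hmom]
    have h4 : genFun (lowerSeq q x) (q * s) = root q (q * s) * -cauchyTransform q h (q * s) := by
      rw [← h2, mul_inv_cancel_left₀ hr]
    rw [h4, lowerProfile, ← hG, cauchyTransform]
    ring
  rw [h3, norm_mul, norm_neg]
  refine (mul_le_of_le_one_left (norm_nonneg _) (norm_root_mul_ofReal_le h0 h1 hs)).trans ?_
  set κ := (1 - q ^ 2)⁻¹ with hκ
  refine (norm_integral_arcsine_le (b := fun t => 2 * κ ^ 5 * (q ^ N * q ^ N) * q ^ N * t ^ N +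
    (κ ^ 3 + κ ^ 4) * q ^ N * (t ^ N * (1 - t))) (by fun_prop) fun t ht => ?_).trans (le_of_eq ?_)
  · have e : h t / (1 - q * s * (q * t)) - (q * t : ℂ) ^ N * G = (q * t : ℂ) ^ N *
        (genFun (upperSeq q x) (q * t) / (1 - q * s * (q * t)) - G) := by
      simp only [hh]; ring
    rw [e, norm_mul, norm_mul_pow h0 ht]
    refine (mul_le_mul_of_nonneg_left (norm_upper_div_sub_le h0 h1 x hN hx hsmall hs ht)
      (mul_nonneg (by positivity) (pow_nonneg ht.1 _))).trans (le_of_eq ?_)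
    ring
  · rw [integral_add (integrable_arcsine (by fun_prop)) (integrable_arcsine (by fun_prop)),
      integral_const_mul, integral_const_mul, integral_pow_arcsine, integral_pow_mul_one_sub,
      lowerError]
    ring

omit x hN hx hsmall in
lemma lipAtOne_lowerProfile {c : ℂ} (hc : c ∈ slitDomain q) :
    LipAtOne fun t => lowerProfile q t * (1 - c * (q * t))⁻¹ :=
  ((lipAtOne_root h0 h1).mul ((lipAtOne_const _).mul
    (lipAtOne_inv_one_sub (mem_slitDomain_of_norm_le_one h0 h1 (by
      simpa [abs_of_pos h0] using h1.le))))).mul (lipAtOne_inv_one_sub hc)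

/-- L is replaced by its leading profile and the profile over 1 - cqt by its value at t = 1. As the
integrand already holds one factor 1-t, the second replacement uses the moment of (1-t)², hence the
ratio 3/(2N+4). -/
lemma norm_correction_add_le {c : ℂ} (hc : c ∈ slitDomain q) {δ L : ℝ} (hδ : 0 < δ)
    (hδc : ∀ t ∈ Icc (0 : ℝ) 1, δ ≤ ‖1 - c * (q * t)‖)
    (hL : ∀ t ∈ Icc (0 : ℝ) 1, ‖lowerProfile q t * (1 - c * (q * t))⁻¹ -
      lowerProfile q 1 * (1 - c * (q * (1 : ℝ)))⁻¹‖ ≤ L * (1 - t)) :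
    ‖cauchyTransform q (fun t => (q * t) ^ N * (1 - t) * genFun (lowerSeq q x) (q * t)) c +
      (q ^ N * q ^ N * (moment N ^ 2 / (2 * N + 2)) : ℝ) *
        (lowerProfile q 1 * (1 - c * (q * (1 : ℝ)))⁻¹)‖ ≤
      q ^ N * q ^ N * (moment N ^ 2 / (2 * N + 2)) *
        (lowerError q N * δ⁻¹ + 3 * L / (2 * N + 4)) := by
  set H1 : ℂ := lowerProfile q 1 * (1 - c * (q * (1 : ℝ)))⁻¹ with hH1
  set μ : ℝ := q ^ N * moment N with hμ
  have hμ0 : 0 ≤ μ := mul_nonneg (by positivity) (moment_pos N).le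
  have hlc : ContinuousOn (fun t : ℝ =>
      (q * t : ℂ) ^ N * (1 - t) * genFun (lowerSeq q x) (q * t)) (Icc 0 1) :=
    ContinuousOn.mul (by fun_prop) (continuousOn_lower h0 h1 x)
  have hmom : ∫ t : ℝ, (q * t : ℂ) ^ N * (1 - t) * (μ * H1) ∂arcsine =
      (q ^ N * q ^ N * (moment N ^ 2 / (2 * N + 2)) : ℝ) * H1 := by
    have e : ∀ t : ℝ, (q * t : ℂ) ^ N * (1 - t) * (μ * H1) =
        ((t ^ N * (1 - t) : ℝ) : ℂ) * (q ^ N * (μ * H1)) := fun t => by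
      push_cast; rw [mul_pow]; ring
    simp_rw [e]
    rw [integral_mul_const, integral_complex_ofReal, integral_pow_mul_one_sub, hμ]
    push_cast
    ring
  rw [← hmom, cauchyTransform, ← integral_add (integrable_arcsine
    (continuousOn_div_one_sub hlc hc)) (integrable_arcsine (by fun_prop))]
  refine (norm_integral_arcsine_le (b := fun t => q ^ N * μ * (lowerError q N * δ⁻¹) *
    (t ^ N * (1 - t)) + q ^ N * μ * L * (t ^ N * (1 - t) ^ 2)) (by fun_prop)
    fun t ht => ?_).trans (le_of_eq ?_)
  · set B := genFun (lowerSeq q x) (q * t)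
    set d := (1 - c * (q * t) : ℂ)⁻¹ with hd
    have ht0 : 0 ≤ 1 - t := by linarith [ht.2]
    have e : (q * t : ℂ) ^ N * (1 - t) * B / (1 - c * (q * t)) +
        (q * t : ℂ) ^ N * (1 - t) * (μ * H1) = (q * t : ℂ) ^ N * (1 - t) *
        ((B + μ * lowerProfile q t) * d - μ * (lowerProfile q t * d - H1)) := by
      rw [div_eq_mul_inv]; ring
    have hB : ‖(B + μ * lowerProfile q t) * d‖ ≤ μ * lowerError q N * δ⁻¹ := by
      have h2 := norm_lower_add_profile_le h0 h1 x hN hx hsmall ht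
      rw [norm_mul]
      refine mul_le_mul ?_ ?_ (norm_nonneg _) ((norm_nonneg _).trans h2)
      · rw [hμ, Complex.ofReal_mul, Complex.ofReal_pow]; exact h2
      · rw [hd, norm_inv]; exact inv_anti₀ hδ (hδc t ht)
    have hP : ‖μ * (lowerProfile q t * d - H1)‖ ≤ μ * (L * (1 - t)) := by
      rw [norm_mul, Complex.norm_real, Real.norm_eq_abs, abs_of_nonneg hμ0]
      exact mul_le_mul_of_nonneg_left (hL t ht) hμ0
    rw [e, norm_mul, norm_mul, norm_mul_pow h0 ht, norm_one_sub_ofReal ht]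
    have h5 : 0 ≤ q ^ N * t ^ N * (1 - t) :=
      mul_nonneg (mul_nonneg (by positivity) (pow_nonneg ht.1 _)) ht0
    refine (mul_le_mul_of_nonneg_left ((norm_sub_le _ _).trans (add_le_add hB hP)) h5).trans
      (le_of_eq ?_)
    ring
  · rw [integral_add (integrable_arcsine (by fun_prop)) (integrable_arcsine (by fun_prop)),
      integral_const_mul, integral_const_mul, integral_pow_mul_one_sub_sq,
      integral_pow_mul_one_sub, hμ]
    field_simp

end Approx

/-! ### Wallis asymptotics and the final form -/

section Asymptotics

variable {q : ℝ} (h0 : 0 < q) (h1 : q < 1)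
include h0 h1

lemma lowerProfile_one : lowerProfile q 1 = (1 - (q : ℂ) ^ 2)⁻¹ := by
  have hne : root q (q * (1 : ℝ)) ≠ 0 :=
    root_ne_zero_of_norm_le h0 h1 ((norm_mul_ofReal_le h0 one_mem_Icc).trans h1.le)
  rw [lowerProfile, mul_inv_cancel_left₀ hne]
  push_cast
  congr 2
  ring

lemma tendsto_mul_sq_pow : Tendsto (fun N : ℕ => (N : ℝ) * (q ^ N * q ^ N)) atTop (𝓝 0) := by
  have := tendsto_self_mul_const_pow_of_lt_one (r := q * q) (by positivity) (by nlinarith)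
  simpa only [mul_pow] using this

lemma eventually_error_le (a b c : ℝ) : ∃ K : ℝ, 0 ≤ K ∧ ∀ᶠ N : ℕ in atTop,
    1 ≤ N ∧ (1 - q ^ 2)⁻¹ ^ 3 * (q ^ N * q ^ N) ≤ 1 / 2 ∧
      (a * (q ^ N * q ^ N) + b / (2 * N + 2)) + c / (2 * N + 4) ≤ K / N := by
  have hm := inv_pos.2 (one_sub_sq_pos h0 h1)
  have h2 := tendsto_mul_sq_pow h0 h1
  have h3 := h2.eventually (gt_mem_nhds (show (0 : ℝ) < 1 / 2 / (1 - q ^ 2)⁻¹ ^ 3 by positivity))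
  have h4 := h2.eventually (gt_mem_nhds (show (0 : ℝ) < 1 by norm_num))
  refine ⟨|a| + |b| + |c|, by positivity, ?_⟩
  filter_upwards [h3, h4, eventually_ge_atTop 1] with N h3 h4 hN
  have hN' : (1 : ℝ) ≤ N := by exact_mod_cast hN
  have hN0 : (0 : ℝ) < N := by linarith
  have hp : 0 ≤ q ^ N * q ^ N := by positivity
  refine ⟨hN, ?_, ?_⟩
  · rw [lt_div_iff₀ (by positivity)] at h3
    nlinarith [pow_pos hm 3]
  · have e1 : a * (q ^ N * q ^ N) ≤ |a| / N := by
      rw [le_div_iff₀ hN0]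
      have : |a| * (N * (q ^ N * q ^ N)) ≤ |a| * 1 :=
        mul_le_mul_of_nonneg_left h4.le (abs_nonneg a)
      have := mul_le_mul_of_nonneg_right (le_abs_self a) (mul_nonneg hN0.le hp)
      linarith
    have e2 : b / (2 * N + 2) ≤ |b| / N :=
      div_le_div₀ (abs_nonneg b) (le_abs_self b) hN0 (by linarith)
    have e3 : c / (2 * N + 4) ≤ |c| / N :=
      div_le_div₀ (abs_nonneg c) (le_abs_self c) hN0 (by linarith)
    rw [add_div, add_div]
    linarith

/-- Leading order of `F_N` with the correction expressed through the arcsine moments. -/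
lemma exists_F_eq {c d : ℂ} (hc : c ∈ slitDomain q)
    (hd : 1 ≤ ‖c‖ → d = isingSymbol q⁻¹ c * c) :
    ∃ K : ℝ, 0 ≤ K ∧ ∀ᶠ N : ℕ in atTop, 1 ≤ N ∧ IsUnit (toeplitz N (isingSymbol q⁻¹)) ∧
      ∃ e : ℂ, ‖e‖ ≤ K / N ∧ F N (isingSymbol q⁻¹) (psi q⁻¹ c d) =
        (root q c)⁻¹ * (1 - q * c * ((q ^ N * q ^ N * (moment N ^ 2 / (2 * N + 2)) : ℝ) *
          ((1 - (q : ℂ) ^ 2)⁻¹ * (1 - q * c)⁻¹ + e))) := by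
  obtain ⟨δ, hδ, hδc⟩ := exists_lower_bound hc
  obtain ⟨L, hL⟩ := lipAtOne_lowerProfile h0 h1 hc
  obtain ⟨K, hK0, hK⟩ := eventually_error_le h0 h1 (2 * (1 - q ^ 2)⁻¹ ^ 5 * δ⁻¹)
    (((1 - q ^ 2)⁻¹ ^ 3 + (1 - q ^ 2)⁻¹ ^ 4) * δ⁻¹) (3 * L)
  refine ⟨K, hK0, hK.mono fun N ⟨hN, hsmall, hle⟩ => ⟨hN, isUnit_toeplitz h0 h1 hN hsmall, ?_⟩⟩
  obtain ⟨x, hx, hF⟩ := exists_row h0 h1 hN hsmall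
  have hest := norm_correction_add_le h0 h1 x hN hx hsmall hc hδ hδc hL
  have hH : lowerProfile q 1 * (1 - c * (q * (1 : ℝ)))⁻¹ =
      (1 - (q : ℂ) ^ 2)⁻¹ * (1 - q * c)⁻¹ := by
    rw [lowerProfile_one h0 h1]; push_cast; congr 2; ring
  rw [hH] at hest
  set J := cauchyTransform q (fun t => (q * t) ^ N * (1 - t) * genFun (lowerSeq q x) (q * t)) c
    with hJ
  set D : ℝ := q ^ N * q ^ N * (moment N ^ 2 / (2 * N + 2)) with hD
  have hDpos : 0 < D := by have := moment_pos N; positivity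
  have hDne : (D : ℂ) ≠ 0 := by exact_mod_cast hDpos.ne'
  -- The witness is the error of the correction integral relative to its positive size D.
  refine ⟨-(J + D * ((1 - (q : ℂ) ^ 2)⁻¹ * (1 - q * c)⁻¹)) / D, ?_, ?_⟩
  · rw [norm_div, norm_neg, Complex.norm_real, Real.norm_eq_abs, abs_of_pos hDpos,
      div_le_iff₀ hDpos]
    refine hest.trans ?_
    rw [mul_comm]
    refine mul_le_mul_of_nonneg_right (le_trans (le_of_eq ?_) hle) hDpos.le
    rw [lowerError]; ring
  · rw [hF]
    simp_rw [coeff_psi h0 h1 hc hd]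
    rw [sum_cauchyTransform_eq h0 h1 x hN hx hc]
    congr 1
    have : (D : ℂ) * ((1 - (q : ℂ) ^ 2)⁻¹ * (1 - q * c)⁻¹ +
        -(J + D * ((1 - (q : ℂ) ^ 2)⁻¹ * (1 - q * c)⁻¹)) / D) = -J := by
      rw [mul_add, mul_div_cancel₀ _ hDne]; ring
    rw [this]
    ring

omit h0 h1 in
/-- Wallis asymptotics: `2π N² α_N² / (2N + 2) = 1 + O(1/N)`. -/
lemma abs_wallis_sub_one_le {N : ℕ} (hN : 1 ≤ N) :
    |2 * Real.pi * (N : ℝ) ^ 2 * (moment N ^ 2 / (2 * (N : ℝ) + 2)) - 1| ≤ 2 / (N : ℝ) := by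
  have hW := moment_sq N
  have h1 := Real.Wallis.W_le N
  have h2 := Real.Wallis.le_W N
  have hWpos := Real.Wallis.W_pos N
  have hpi := Real.pi_pos
  have hN' : (1 : ℝ) ≤ N := by exact_mod_cast hN
  set n : ℝ := (N : ℝ)
  set W := Real.Wallis.W N
  have hm : moment N ^ 2 = 1 / ((2 * n + 1) * W) := by
    rw [eq_div_iff (by positivity)]; exact hW
  rw [hm]
  have e : 2 * Real.pi * n ^ 2 * (1 / ((2 * n + 1) * W) / (2 * n + 2)) =
      2 * Real.pi * n ^ 2 / ((2 * n + 1) * (2 * n + 2) * W) := by field_simp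
  rw [e]
  -- Lower bound on W for the upper estimate and W ≤ π/2 for the lower one; what remains compares
  -- 4n² with (2n+1)² and with (2n+1)(2n+2).
  have hup : 2 * Real.pi * n ^ 2 / ((2 * n + 1) * (2 * n + 2) * W) ≤ 1 := by
    rw [div_le_one (by positivity)]
    calc 2 * Real.pi * n ^ 2 ≤ (2 * n + 1) * (2 * n + 1) * (Real.pi / 2) := by
          nlinarith [mul_pos hpi (show 0 < n by linarith)]
      _ = (2 * n + 1) * (2 * n + 2) * ((2 * n + 1) / (2 * n + 2) * (Real.pi / 2)) := by
          field_simp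
      _ ≤ _ := by gcongr
  have hlo : 1 - 2 / n ≤ 2 * Real.pi * n ^ 2 / ((2 * n + 1) * (2 * n + 2) * W) := by
    have h3 : 1 - 2 / n ≤ 4 * n ^ 2 / ((2 * n + 1) * (2 * n + 2)) := by
      rw [sub_le_iff_le_add, ← sub_le_iff_le_add', le_div_iff₀ (by linarith)]
      have : (1 - 4 * n ^ 2 / ((2 * n + 1) * (2 * n + 2))) =
          (6 * n + 2) / ((2 * n + 1) * (2 * n + 2)) := by field_simp; ring
      rw [this, div_mul_eq_mul_div, div_le_iff₀ (by positivity)]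
      nlinarith
    refine h3.trans ?_
    calc 4 * n ^ 2 / ((2 * n + 1) * (2 * n + 2)) =
        2 * Real.pi * n ^ 2 / ((2 * n + 1) * (2 * n + 2) * (Real.pi / 2)) := by field_simp; ring
      _ ≤ _ := by gcongr
  rw [abs_le]
  have : 0 ≤ 2 / n := by positivity
  constructor <;> linarith

omit h0 h1 in
-- The positive factor k = 1/q may be pulled out of the principal power of k - c = k(1 - qc), since
-- it leaves the argument unchanged.
lemma cpow_div_cpow_eq (h0 : 0 < q) {c : ℂ} (hc : c ∈ slitDomain q) :
    ((q⁻¹ : ℝ) : ℂ) ^ (1 / 2 : ℂ) / (((q⁻¹ : ℝ) : ℂ) - c) ^ (1 / 2 : ℂ) = (root q c)⁻¹ := by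
  have hq : (q : ℂ) ≠ 0 := by exact_mod_cast h0.ne'
  have e : (((q⁻¹ : ℝ) : ℂ) - c) = ((q⁻¹ : ℝ) : ℂ) * (1 - q * c) := by
    push_cast; field_simp
  have hroot := root_ne_zero (Complex.slitPlane_ne_zero hc)
  have hk : ((q⁻¹ : ℝ) : ℂ) ^ (1 / 2 : ℂ) ≠ 0 := by
    rw [Complex.cpow_ne_zero_iff_of_exponent_ne_zero (by norm_num)]
    exact_mod_cast (inv_pos.2 h0).ne'
  have h2 : (((q⁻¹ : ℝ) : ℂ) * (1 - q * c)) ^ (1 / 2 : ℂ) =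
      ((q⁻¹ : ℝ) : ℂ) ^ (1 / 2 : ℂ) * root q c := by
    have h3 := Complex.slitPlane_ne_zero hc
    have h4 : ((q⁻¹ : ℝ) : ℂ) ≠ 0 := by exact_mod_cast (inv_pos.2 h0).ne'
    rw [root, Complex.cpow_def_of_ne_zero (mul_ne_zero h4 h3), Complex.cpow_def_of_ne_zero h4,
      Complex.cpow_def_of_ne_zero h3, Complex.log_ofReal_mul (inv_pos.2 h0) h3, ← Complex.exp_add,
      Complex.ofReal_log (inv_pos.2 h0).le, add_mul]
  rw [e, h2, ← div_div, div_self hk, one_div]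

omit h0 h1 in
lemma mem_slitDomain_of_notMem_ray (h0 : 0 < q) {c : ℂ}
    (hc : c ∉ Complex.ofReal '' Set.Ici q⁻¹) : c ∈ slitDomain q := by
  rw [slitDomain, mem_ofPred_eq, Complex.mem_slitPlane_iff]
  by_contra! h
  obtain ⟨hre, him⟩ := h
  simp only [Complex.sub_re, Complex.one_re, Complex.mul_re, Complex.ofReal_re, Complex.ofReal_im,
    zero_mul, sub_zero, Complex.sub_im, Complex.one_im, Complex.mul_im, add_zero, zero_sub,
    neg_eq_zero, mul_eq_zero, h0.ne', false_or] at hre him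
  refine hc ⟨c.re, ?_, Complex.ext rfl (by simp [him])⟩
  rw [mem_Ici, inv_le_iff_one_le_mul₀ h0]
  linarith

end Asymptotics

end BorderedToeplitz

end

open BorderedToeplitz in
theorem theorem3p8 (k : ℝ) (hk : 1 < k) (c : ℂ)
    (hc : c ∉ Complex.ofReal '' Set.Ici k) (d : ℂ)
    (hd : 1 ≤ ‖c‖ → d = BorderedToeplitz.isingSymbol k c * c) :
    ∃ ε : ℕ → ℂ,
      Asymptotics.IsBigO Filter.atTop ε (fun N : ℕ => (1 : ℝ) / (N : ℝ)) ∧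
      ∀ᶠ N : ℕ in Filter.atTop,
        IsUnit (BorderedToeplitz.toeplitz N (BorderedToeplitz.isingSymbol k)) ∧
        BorderedToeplitz.F N (BorderedToeplitz.isingSymbol k) (BorderedToeplitz.psi k c d) =
          (k : ℂ) ^ (1 / 2 : ℂ) / ((k : ℂ) - c) ^ (1 / 2 : ℂ) -
            c * (k : ℂ) ^ (1 / 2 : ℂ) /
                (2 * (Real.pi : ℂ) * ((k : ℂ) - c) ^ (3 / 2 : ℂ) *
                  (1 - (k : ℂ) ^ (-2 : ℤ))) *
              ((N : ℂ) ^ (-2 : ℤ) * (k : ℂ) ^ (-2 * (N : ℤ)) * (1 + ε N)) := by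
  obtain ⟨q, rfl⟩ : ∃ q : ℝ, k = q⁻¹ := ⟨k⁻¹, by simp⟩
  have h0 : 0 < q := inv_pos.1 (by linarith)
  have h1 : q < 1 := (one_lt_inv₀ h0).1 hk
  have hcs := mem_slitDomain_of_notMem_ray h0 hc
  obtain ⟨K, hK0, hK⟩ := exists_F_eq h0 h1 hcs hd
  obtain ⟨N₀, hN₀⟩ := Filter.eventually_atTop.1 hK
  -- The errors exist only from N₀ on; below it 0 is a filler, so that a full sequence can be
  -- chosen.
  have hex : ∀ N : ℕ, ∃ e : ℂ, N₀ ≤ N → ‖e‖ ≤ K / N ∧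
      F N (isingSymbol q⁻¹) (psi q⁻¹ c d) = (root q c)⁻¹ *
        (1 - q * c * ((q ^ N * q ^ N * (moment N ^ 2 / (2 * N + 2)) : ℝ) *
          ((1 - (q : ℂ) ^ 2)⁻¹ * (1 - q * c)⁻¹ + e))) := by
    intro N
    by_cases h : N₀ ≤ N
    · obtain ⟨-, -, e, he⟩ := hN₀ N h
      exact ⟨e, fun _ => he⟩
    · exact ⟨0, fun h' => absurd h' h⟩
  choose e he using hex
  set M : ℂ := (1 - (q : ℂ) ^ 2) * (1 - q * c) with hM
  set r : ℕ → ℝ := fun N => 2 * Real.pi * (N : ℝ) ^ 2 * (moment N ^ 2 / (2 * (N : ℝ) + 2)) with hr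
  -- Forced by the claimed formula for c ≠ 0: r N is the Wallis ratio of α_N²/(2N+2) to 1/(2πN²),
  -- and 1 + e N * M is the relative error of the frozen integral, whose main term is 1/M.
  refine ⟨fun N => r N * (1 + e N * M) - 1, ?_, ?_⟩
  · refine Asymptotics.IsBigO.of_bound (2 + 3 * (K * ‖M‖)) ?_
    filter_upwards [Filter.eventually_ge_atTop N₀] with N hN
    have hN1 : 1 ≤ N := (hN₀ N hN).1
    have hN1' : (1 : ℝ) ≤ N := by exact_mod_cast hN1
    have hw : |r N - 1| ≤ 2 / N := abs_wallis_sub_one_le hN1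
    have hrN : |r N| ≤ 3 := by
      have h2 : (2 : ℝ) / N ≤ 2 := div_le_self (by norm_num) hN1'
      rw [abs_le] at hw ⊢
      constructor <;> linarith [hw.1, hw.2]
    have hsplit : (r N * (1 + e N * M) - 1 : ℂ) = ((r N - 1 : ℝ) : ℂ) + r N * (e N * M) := by
      push_cast; ring
    rw [hsplit, Real.norm_eq_abs, abs_of_nonneg (by positivity)]
    refine (norm_add_le _ _).trans ?_
    rw [Complex.norm_real, Real.norm_eq_abs, norm_mul, norm_mul, Complex.norm_real,
      Real.norm_eq_abs]
    calc |r N - 1| + |r N| * (‖e N‖ * ‖M‖) ≤ 2 / N + 3 * (K / N * ‖M‖) := by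
          have := (he N hN).1
          gcongr
      _ = _ := by ring
  · filter_upwards [Filter.eventually_ge_atTop N₀] with N hN
    obtain ⟨hN1, hunit, -⟩ := hN₀ N hN
    refine ⟨hunit, ?_⟩
    have hq : (q : ℂ) ≠ 0 := by exact_mod_cast h0.ne'
    have hNne : (N : ℂ) ≠ 0 := by exact_mod_cast (by omega : N ≠ 0)
    have hpi : (Real.pi : ℂ) ≠ 0 := by exact_mod_cast Real.pi_ne_zero
    have hqc : 1 - q * c ≠ 0 := Complex.slitPlane_ne_zero hcs
    have hq2 : (1 - (q : ℂ) ^ 2) ≠ 0 := by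
      have := (one_sub_sq_pos h0 h1).ne'
      exact_mod_cast this
    have hkc : (((q⁻¹ : ℝ) : ℂ) - c) = (1 - q * c) / q := by push_cast; field_simp
    have hkc0 : (((q⁻¹ : ℝ) : ℂ) - c) ≠ 0 := by rw [hkc]; exact div_ne_zero hqc hq
    have hroot := cpow_div_cpow_eq h0 hcs
    have h32 : (((q⁻¹ : ℝ) : ℂ) - c) ^ (3 / 2 : ℂ) =
        (((q⁻¹ : ℝ) : ℂ) - c) ^ (1 / 2 : ℂ) * ((1 - q * c) / q) := by
      rw [show (3 / 2 : ℂ) = 1 / 2 + 1 by norm_num, Complex.cpow_add _ _ hkc0, Complex.cpow_one]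
      rw [← hkc]
    have hk2 : ((q⁻¹ : ℝ) : ℂ) ^ (-2 : ℤ) = (q : ℂ) ^ 2 := by
      push_cast
      rw [zpow_neg, inv_zpow, inv_inv]
      norm_cast
    have hk2N : ((q⁻¹ : ℝ) : ℂ) ^ (-2 * (N : ℤ)) = (q : ℂ) ^ N * (q : ℂ) ^ N := by
      rw [zpow_mul, hk2, zpow_natCast, ← pow_mul, ← pow_add]
      congr 1; ring
    have hN2 : (N : ℂ) ^ (-2 : ℤ) = ((N : ℂ) ^ 2)⁻¹ := by rw [zpow_neg]; norm_cast
    have hcoef : c * ((q⁻¹ : ℝ) : ℂ) ^ (1 / 2 : ℂ) / (2 * (Real.pi : ℂ) *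
        ((((q⁻¹ : ℝ) : ℂ) - c) ^ (1 / 2 : ℂ) * ((1 - q * c) / q)) * (1 - (q : ℂ) ^ 2)) =
        (root q c)⁻¹ * (c * q / (2 * Real.pi * M)) := by
      rw [← hroot, hM]
      have hne : (((q⁻¹ : ℝ) : ℂ) - c) ^ (1 / 2 : ℂ) ≠ 0 := by
        rw [Complex.cpow_ne_zero_iff_of_exponent_ne_zero (by norm_num)]
        exact hkc0
      field_simp
    rw [(he N hN).2, h32, hk2, hk2N, hN2, hcoef, hroot]
    have hM0 : M ≠ 0 := mul_ne_zero hq2 hqc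
    have hH : (1 - (q : ℂ) ^ 2)⁻¹ * (1 - q * c)⁻¹ + e N = (1 + e N * M) / M := by
      rw [add_div, mul_div_assoc, div_self hM0, mul_one, hM, one_div, mul_inv]
    have h2N : (2 * (N : ℂ) + 2) ≠ 0 := by exact_mod_cast (by omega : 2 * N + 2 ≠ 0)
    rw [hH, hr]
    push_cast
    field_simp
    ring
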